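/- For $c\in\mathbb{R}$ let $\mathbb{H}_c=L^2(\mathbb{R},e^{-2ct}\,dt)$ (complex-valued functions), and let $\partial_c f=f'$ be the unbounded normal operator on $\mathbb{H}_c$ with domain $D(\partial_c)=\{f\in\mathbb{H}_c : f \text{ is locally absolutely continuous and } f'\in\mathbb{H}_c\}$. For Borel measurable $\varphi:\mathbb{C}\to\mathbb{C}$ let $\varphi(\partial_c)=\int\varphi\,dE$ be given by the measurable functional calculus, where $E$ is the spectral measure of $\partial_c$; in particular $\zeta(\partial_c)$ is defined through the Riemann zeta function and $n^{-\partial_c}$ through $s\mapsto n^{-s}$. The spectral operator $\mathfrak{a}_c$ is $\zeta(\partial_c)$ with domain $D(\mathfrak{a}_c)=\{f\in D(\partial_c) : \zeta(\partial_c)f\in\mathbb{H}_c\}$, that is, the restriction of $\zeta(\partial_c)$ to $D(\partial_c)\cap D(\zeta(\partial_c))$. Assume $c>1$. Then $\mathfrak{a}_c$ extends uniquely to a bounded linear operator on $\mathbb{H}_c$, again denoted $\mathfrak{a}_c$. The operators $\zeta(\partial_c)$ and $n^{-\partial_c}$ $(n\ge 1)$ are bounded and defined on all of $\mathbb{H}_c$,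 and $$\mathfrak{a}_c=\zeta(\partial_c)=\sum_{n=1}^{\infty}n^{-\partial_c},$$ where the series converges in the norm of $\mathcal{B}(\mathbb{H}_c)$. Moreover, for every $f\in\mathbb{H}_c$ and $n\ge1$ one has $(n^{-\partial_c}f)(t)=f(t-\log n)$ for almost every $t$, and $$\mathfrak{a}_c f(t)=\sum_{n=1}^{\infty}f(t-\log n),$$ where the series converges to $\mathfrak{a}_cf$ both in $\mathbb{H}_c$ and, absolutely, for almost every $t\in\mathbb{R}$. -/

import Mathlib

open MeasureTheory Filter Topology
open scoped ENNReal InnerProductSpace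

noncomputable section

/-! ### Spectral measures and functions of an unbounded normal operator -/

/-- A resolution of the identity (projection-valued measure) on a measurable space `α`, acting on
the Hilbert space `H`: orthogonal projections `E(B)`, multiplicative on intersections, with
`E(α) = 1` and strongly countably additive.  Values on non-measurable sets are irrelevant. -/
structure ResolutionOfIdentity (α : Type*) [MeasurableSpace α] (H : Type*)
    [NormedAddCommGroup H] [InnerProductSpace ℂ H] [CompleteSpace H] where
  proj : Set α → H →L[ℂ] H
  isStarProjection : ∀ B, MeasurableSet B → IsStarProjection (proj B)
  proj_univ : proj Set.univ = 1
  proj_inter : ∀ B C, MeasurableSet B → MeasurableSet C → proj (B ∩ C) = proj B * proj C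
  hasSum_proj : ∀ B : ℕ → Set α, (∀ i, MeasurableSet (B i)) →
    Pairwise (Function.onFun Disjoint B) →
    ∀ x, HasSum (fun i => proj (B i) x) (proj (⋃ i, B i) x)

namespace ResolutionOfIdentity

variable {α : Type*} [MeasurableSpace α] {H : Type*}
  [NormedAddCommGroup H] [InnerProductSpace ℂ H] [CompleteSpace H]

theorem inner_proj_eq (E : ResolutionOfIdentity α H) {B : Set α} (hB : MeasurableSet B) (x : H) :
    ⟪x, E.proj B x⟫_ℂ = ((‖E.proj B x‖ ^ 2 : ℝ) : ℂ) := by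
  have h := E.isStarProjection B hB
  have h1 : E.proj B (E.proj B x) = E.proj B x := by
    have := congrArg (fun T : H →L[ℂ] H => T x) h.isIdempotentElem.eq
    simpa using this
  have h2 : ContinuousLinearMap.adjoint (E.proj B) = E.proj B := h.isSelfAdjoint.star_eq
  calc ⟪x, E.proj B x⟫_ℂ = ⟪x, E.proj B (E.proj B x)⟫_ℂ := by rw [h1]
    _ = ⟪E.proj B x, E.proj B x⟫_ℂ := by
        rw [← ContinuousLinearMap.adjoint_inner_left, h2]
    _ = _ := by rw [inner_self_eq_norm_sq_to_K]; norm_cast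

/-- The finite positive measure `E_{x,x}(B) = ⟪x, E(B) x⟫ = ‖E(B) x‖²`. -/
def scalarMeasure (E : ResolutionOfIdentity α H) (x : H) : Measure α :=
  Measure.ofMeasurable (fun B _ => ENNReal.ofReal (‖E.proj B x‖ ^ 2))
    (by
      have h := (E.hasSum_proj (fun _ => ∅) (fun _ => MeasurableSet.empty)
        (fun _ _ _ => disjoint_bot_left) x).summable
      have h0 : E.proj ∅ x = 0 := tendsto_nhds_unique tendsto_const_nhds h.tendsto_atTop_zero
      simp [h0])
    (by
      intro B hB hd
      have h := (E.hasSum_proj B hB hd x).mapL (innerSL ℂ x)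
      simp only [innerSL_apply_apply] at h
      rw [E.inner_proj_eq (MeasurableSet.iUnion hB)] at h
      simp only [E.inner_proj_eq (hB _)] at h
      have h' := Complex.hasSum_ofReal.mp h
      rw [← h'.tsum_eq, ENNReal.ofReal_tsum_of_nonneg (fun _ => by positivity) h'.summable])

/-- `T = ∫ φ dE`: the domain of `T` consists of the `x` with `∫ |φ|² dE_{x,x} < ∞`, and
`⟪x, T x⟫ = ∫ φ dE_{x,x}` there.  As this domain is a dense complex subspace, polarization shows
that these two conditions determine `T`. -/
def IsSpectralIntegral (E : ResolutionOfIdentity α H) (φ : α → ℂ) (T : H →ₗ.[ℂ] H) : Prop :=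
  (∀ x : H, x ∈ T.domain ↔ MemLp φ 2 (E.scalarMeasure x)) ∧
    ∀ x : T.domain, ⟪(x : H), T x⟫_ℂ = ∫ a, φ a ∂(E.scalarMeasure x)

end ResolutionOfIdentity

open Classical in
/-- The measurable functional calculus `φ(A) = ∫ φ dE`, where `E` is the spectral measure of `A`,
that is, the resolution of the identity on `ℂ` with `A = ∫ λ dE(λ)`.  For `A` normal and `φ` Borel,
`E` and `φ(A)` exist and are unique; the value `⊥` (the operator with domain `{0}`) is only assigned
where there is no such `E` or no such integral. -/
def functionOfOperator {H : Type*} [NormedAddCommGroup H] [InnerProductSpace ℂ H] [CompleteSpace H]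
    (A : H →ₗ.[ℂ] H) (φ : ℂ → ℂ) : H →ₗ.[ℂ] H :=
  if h : ∃ T : H →ₗ.[ℂ] H, ∃ E : ResolutionOfIdentity ℂ H,
      E.IsSpectralIntegral (fun s => s) A ∧ E.IsSpectralIntegral φ T
  then h.choose else ⊥

/-! ### The weighted Hilbert space, the infinitesimal shift and the spectral operator -/

/-- The measure `e^{-2ct} dt` on the real line. -/
def weightMeasure (c : ℝ) : Measure ℝ :=
  volume.withDensity (fun t => ENNReal.ofReal (Real.exp (-2 * c * t)))

/-- The Hilbert space `ℍ_c = L²(ℝ, e^{-2ct} dt)` of complex-valued functions. -/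
abbrev WeightedL2 (c : ℝ) : Type := Lp ℂ 2 (weightMeasure c)

/-- The graph of `∂_c`: pairs `(f, g)` in `ℍ_c × ℍ_c` such that `f` has a locally absolutely
continuous representative `F` with `F' = g` almost everywhere. -/
def shiftGraph (c : ℝ) : Submodule ℂ (WeightedL2 c × WeightedL2 c) where
  carrier := {p | ∃ F : ℝ → ℂ, p.1 =ᵐ[weightMeasure c] F ∧
    (∀ a b : ℝ, AbsolutelyContinuousOnInterval F a b) ∧
    ∀ᵐ t ∂(weightMeasure c), HasDerivAt F (p.2 t) t}
  zero_mem' := by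
    refine ⟨0, Lp.coeFn_zero _ _ _, fun a b => ?_, ?_⟩
    · exact ((contDiff_const (c := (0 : ℂ))).contDiffOn).absolutelyContinuousOnInterval
    · filter_upwards [Lp.coeFn_zero ℂ 2 (weightMeasure c)] with t ht
      have : (0 : WeightedL2 c × WeightedL2 c).2 t = 0 := by simpa using ht
      rw [this]
      exact hasDerivAt_const t 0
  add_mem' := by
    rintro p q ⟨F, hF, hFa, hFd⟩ ⟨G, hG, hGa, hGd⟩
    refine ⟨F + G, ?_, fun a b => (hFa a b).add (hGa a b), ?_⟩
    · exact (Lp.coeFn_add p.1 q.1).trans (hF.add hG)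
    · filter_upwards [hFd, hGd, Lp.coeFn_add p.2 q.2] with t h1 h2 h3
      have : (p + q).2 t = p.2 t + q.2 t := by simpa using h3
      rw [this]
      exact h1.add h2
  smul_mem' := by
    rintro r p ⟨F, hF, hFa, hFd⟩
    refine ⟨r • F, ?_, fun a b => (hFa a b).const_smul r, ?_⟩
    · exact (Lp.coeFn_smul r p.1).trans (hF.const_smul r)
    · filter_upwards [hFd, Lp.coeFn_smul r p.2] with t h1 h3
      have : (r • p).2 t = r • p.2 t := by simpa using h3
      rw [this]
      exact h1.const_smul r

/-- The graph is single-valued: the derivative depends only on the class of `f`. -/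
theorem shiftGraph_singleValued (c : ℝ) (p : WeightedL2 c × WeightedL2 c)
    (hp : p ∈ shiftGraph c) (h0 : p.1 = 0) : p.2 = 0 := by
  obtain ⟨F, hF, hFa, hFd⟩ := hp
  have hac : volume ≪ weightMeasure c :=
    withDensity_absolutelyContinuous' (by fun_prop)
      (Eventually.of_forall fun t => by simp [Real.exp_pos])
  have hcont : Continuous F := by
    rw [continuous_iff_continuousAt]
    intro t
    refine (hFa (t - 1) (t + 1)).continuousOn.continuousAt ?_
    rw [Set.uIcc_of_le (by linarith)]
    exact Icc_mem_nhds (by linarith) (by linarith)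
  have hz : F =ᵐ[weightMeasure c] 0 := by
    rw [h0] at hF
    exact hF.symm.trans (Lp.coeFn_zero _ _ _)
  have hF0 : F = 0 := (hcont.ae_eq_iff_eq volume continuous_zero).mp (hac.ae_le hz)
  refine Lp.ext ?_
  filter_upwards [hFd, Lp.coeFn_zero ℂ 2 (weightMeasure c)] with t ht hzt
  rw [hF0] at ht
  rw [hzt]
  exact ht.unique (hasDerivAt_const t 0)

/-- The infinitesimal shift `∂_c f = f'` with domain
`{f ∈ ℍ_c ∩ AC(ℝ) : f' ∈ ℍ_c}`, an unbounded operator on `ℍ_c`. -/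
def infinitesimalShift (c : ℝ) : WeightedL2 c →ₗ.[ℂ] WeightedL2 c :=
  (shiftGraph c).toLinearPMap

/-- The spectral operator `𝔞_c`: the operator `ζ(∂_c)` on the domain
`{f ∈ D(∂_c) : ζ(∂_c) f ∈ ℍ_c}`. -/
def spectralOperator (c : ℝ) : WeightedL2 c →ₗ.[ℂ] WeightedL2 c :=
  (functionOfOperator (infinitesimalShift c) riemannZeta).domRestrict (infinitesimalShift c).domain

/-- A bounded operator, defined everywhere, seen as a partially defined operator. -/
def boundedAsPartial {H : Type*} [NormedAddCommGroup H] [InnerProductSpace ℂ H]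
    (T : H →L[ℂ] H) : H →ₗ.[ℂ] H :=
  (T : H →ₗ[ℂ] H).toPMap ⊤

end

/-!
The unitary `f ↦ 𝓕 (e^{-ct} f)` of `ℍ_c` onto `L²(ℝ)` carries `∂_c` to multiplication by
`c + 2πiξ` and the translation by `log n` to multiplication by `n^{-(c + 2πiξ)}`. The translation
by `log n` has norm at most `n^{-c}`, so for `c > 1` the sum over `n` converges in operator norm;
it is carried to multiplication by `∑ n^{-(c + 2πiξ)} = ζ(c + 2πiξ)`.

To identify these operators as functions of `∂_c` one needs the uniqueness of the spectral measure
`E` of an operator `A` which a unitary `W` carries to multiplication by `m`. A vector `y` in the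
range of `E (ball z r)` satisfies `‖(A - z)^k y‖ ≤ (2r)^k ‖y‖` for all `k`, which forces
`|m - z| ≤ 2r` wherever `W y ≠ 0`. Hence that range lies in the range of the canonical projection
attached to `closedBall z (2r)`, and this suffices to compare the scalar measures of the two
spectral measures on open sets.
-/

section Polarization

variable {H : Type*} [NormedAddCommGroup H] [InnerProductSpace ℂ H]

theorem norm_apply_le_of_norm_inner_apply_self_le (T : H →ₗ[ℂ] H) {r : ℝ}
    (hT : ∀ x, ‖⟪T x, x⟫_ℂ‖ ≤ r * ‖x‖ ^ 2) (x : H) : ‖T x‖ ≤ 2 * r * ‖x‖ := by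
  have hpol (y : H) : ‖⟪T x, y⟫_ℂ‖ ≤ r * (‖x‖ ^ 2 + ‖y‖ ^ 2) := by
    have hadd := parallelogram_law_with_norm ℂ y x
    have haddI := parallelogram_law_with_norm ℂ y (Complex.I • x)
    rw [norm_smul, Complex.norm_I, one_mul] at haddI
    rw [inner_map_polarization, norm_div, Complex.norm_ofNat, div_le_iff₀ (by norm_num)]
    calc _ ≤ _ := (norm_sub_le _ _).trans
          (add_le_add_left ((norm_add_le _ _).trans (add_le_add_left (norm_sub_le _ _) _)) _)
      _ ≤ r * ‖y + x‖ ^ 2 + r * ‖y - x‖ ^ 2 + r * ‖y + Complex.I • x‖ ^ 2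
          + r * ‖y - Complex.I • x‖ ^ 2 := by
        simp only [norm_mul, Complex.norm_I, one_mul]
        gcongr <;> exact hT _
      _ = r * (‖x‖ ^ 2 + ‖y‖ ^ 2) * 4 := by linear_combination r * hadd + r * haddI
  rcases (norm_nonneg (T x)).eq_or_lt' with h0 | h0
  · rw [h0]
    rcases (norm_nonneg x).eq_or_lt' with hx | hx
    · simp [hx]
    · have hr : 0 ≤ r :=
        nonneg_of_mul_nonneg_left ((norm_nonneg _).trans (hT x)) (by positivity)
      positivity
  · rcases (norm_nonneg x).eq_or_lt' with hx | hx
    · simp [norm_eq_zero.1 hx]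
    -- the optimal test vector: `T x` rescaled to the norm of `x`
    have h := hpol (((‖x‖ / ‖T x‖ : ℝ) : ℂ) • T x)
    rw [inner_smul_right, norm_mul, norm_smul, Complex.norm_real, norm_div, norm_norm, norm_norm,
      inner_self_eq_norm_sq_to_K, norm_pow, RCLike.norm_ofReal, abs_norm,
      div_mul_cancel₀ _ h0.ne', div_mul_eq_mul_div, div_le_iff₀ h0] at h
    have hmul : ‖x‖ * ‖T x‖ * ‖T x‖ ≤ ‖x‖ * ‖T x‖ * (2 * r * ‖x‖) := by linear_combination h
    exact le_of_mul_le_mul_left hmul (by positivity)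

theorem inner_apply_eq_zero_of_quadratic_additive {D : Submodule ℂ H} (S : D →ₗ[ℂ] H) {y z : D}
    (h : ∀ a : ℂ, ⟪((y + a • z : D) : H), S (y + a • z)⟫_ℂ =
      ⟪(y : H), S y⟫_ℂ + ⟪((a • z : D) : H), S (a • z)⟫_ℂ) :
    ⟪(z : H), S y⟫_ℂ = 0 := by
  have h1 := h 1
  have hI := h Complex.I
  simp only [map_add, map_smul, Submodule.coe_add, Submodule.coe_smul, inner_add_left,
    inner_add_right, inner_smul_left, inner_smul_right, Complex.conj_I, map_one] at h1 hI
  have hI' := congrArg (Complex.I * ·) hI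
  ring_nf at hI'
  rw [Complex.I_sq] at hI'
  linear_combination (1 / 2 : ℂ) * h1 + (1 / 2 : ℂ) * hI'

theorem hasSum_of_orthogonal_of_hasSum_norm_sq {ι : Type*} {v : ι → H} {y : H}
    (hv : Pairwise fun i j => ⟪v i, v j⟫_ℂ = 0) (hy : ∀ i, ⟪v i, y⟫_ℂ = (‖v i‖ : ℂ) ^ 2)
    (h : HasSum (fun i => ‖v i‖ ^ 2) (‖y‖ ^ 2)) : HasSum v y := by
  have hdist (s : Finset ι) : ‖(∑ i ∈ s, v i) - y‖ ^ 2 = ‖y‖ ^ 2 - ∑ i ∈ s, ‖v i‖ ^ 2 := by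
    have hnorm : ‖∑ i ∈ s, v i‖ ^ 2 = ∑ i ∈ s, ‖v i‖ ^ 2 := by
      classical
      induction s using Finset.induction_on with
      | empty => simp
      | insert i s hi ih =>
        have : ⟪v i, ∑ j ∈ s, v j⟫_ℂ = 0 := by
          rw [inner_sum]
          exact Finset.sum_eq_zero fun j hj => hv (by rintro rfl; exact hi hj)
        rw [Finset.sum_insert hi, Finset.sum_insert hi, ← ih, sq, sq, sq]
        exact norm_add_sq_eq_norm_sq_add_norm_sq_of_inner_eq_zero _ _ this
    have hinner : RCLike.re ⟪∑ i ∈ s, v i, y⟫_ℂ = ∑ i ∈ s, ‖v i‖ ^ 2 := by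
      rw [sum_inner, map_sum]
      refine Finset.sum_congr rfl fun i _ => ?_
      rw [hy, ← Complex.ofReal_pow]
      exact Complex.ofReal_re _
    rw [norm_sub_sq (𝕜 := ℂ), hnorm, hinner]
    ring
  rw [HasSum, SummationFilter.unconditional_filter] at h ⊢
  rw [tendsto_iff_norm_sub_tendsto_zero]
  have hlim : Tendsto (fun s : Finset ι => √(‖y‖ ^ 2 - ∑ i ∈ s, ‖v i‖ ^ 2)) atTop (𝓝 0) := by
    have h0 := (h.const_sub (‖y‖ ^ 2)).sqrt
    rwa [sub_self, Real.sqrt_zero] at h0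
  refine hlim.congr fun s => ?_
  rw [← hdist, Real.sqrt_sq (norm_nonneg _)]

end Polarization

namespace ResolutionOfIdentity

variable {α : Type*} [MeasurableSpace α] {H : Type*}
  [NormedAddCommGroup H] [InnerProductSpace ℂ H] [CompleteSpace H]

section Projections

variable (E : ResolutionOfIdentity α H) {B C : Set α} (x : H)

theorem proj_proj (hB : MeasurableSet B) (hC : MeasurableSet C) :
    E.proj B (E.proj C x) = E.proj (B ∩ C) x := by
  rw [E.proj_inter B C hB hC]; rfl

theorem proj_self_apply (hB : MeasurableSet B) : E.proj B (E.proj B x) = E.proj B x := by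
  rw [E.proj_proj x hB hB, Set.inter_self]

theorem inner_proj_left (hB : MeasurableSet B) (y : H) :
    ⟪E.proj B x, y⟫_ℂ = ⟪x, E.proj B y⟫_ℂ :=
  (E.isStarProjection B hB).isSelfAdjoint.isSymmetric x y

theorem scalarMeasure_apply (hB : MeasurableSet B) :
    E.scalarMeasure x B = ENNReal.ofReal (‖E.proj B x‖ ^ 2) :=
  Measure.ofMeasurable_apply B hB

theorem scalarMeasure_eq_zero_iff (hB : MeasurableSet B) :
    E.scalarMeasure x B = 0 ↔ E.proj B x = 0 := by
  rw [E.scalarMeasure_apply x hB, ENNReal.ofReal_eq_zero]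
  exact ⟨fun h => by simpa using le_antisymm h (by positivity), fun h => by simp [h]⟩

theorem scalarMeasure_univ : E.scalarMeasure x Set.univ = ENNReal.ofReal (‖x‖ ^ 2) := by
  rw [E.scalarMeasure_apply x MeasurableSet.univ, E.proj_univ]; rfl

instance : IsFiniteMeasure (E.scalarMeasure x) :=
  ⟨by rw [E.scalarMeasure_univ]; exact ENNReal.ofReal_lt_top⟩

theorem measureReal_scalarMeasure_univ : (E.scalarMeasure x).real Set.univ = ‖x‖ ^ 2 := by
  rw [measureReal_def, E.scalarMeasure_univ, ENNReal.toReal_ofReal (by positivity)]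

theorem scalarMeasure_proj (hB : MeasurableSet B) :
    E.scalarMeasure (E.proj B x) = (E.scalarMeasure x).restrict B := by
  ext C hC
  rw [Measure.restrict_apply hC, E.scalarMeasure_apply _ hC, E.scalarMeasure_apply _ (hC.inter hB),
    E.proj_proj x hC hB]

theorem proj_eq_self_iff (hB : MeasurableSet B) : E.proj B x = x ↔ E.proj Bᶜ x = 0 := by
  constructor <;> intro h
  · rw [← E.scalarMeasure_eq_zero_iff x hB.compl, ← h, E.scalarMeasure_proj x hB,
      Measure.restrict_apply hB.compl, Set.compl_inter_self, measure_empty]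
  · -- Pythagoras: `‖x‖² = ‖E(B) x‖² + ‖E(Bᶜ) x‖²`
    have hmeas : E.scalarMeasure x B = E.scalarMeasure x Set.univ := by
      rw [← measure_add_measure_compl hB, (E.scalarMeasure_eq_zero_iff x hB.compl).2 h, add_zero]
    rw [E.scalarMeasure_apply x hB, E.scalarMeasure_univ,
      ENNReal.ofReal_eq_ofReal_iff (by positivity) (by positivity)] at hmeas
    have hinner : RCLike.re ⟪E.proj B x, x⟫_ℂ = ‖E.proj B x‖ ^ 2 := by
      rw [E.inner_proj_left x hB, E.inner_proj_eq hB]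
      exact Complex.ofReal_re _
    rw [← sub_eq_zero, ← norm_eq_zero, ← sq_eq_zero_iff, norm_sub_sq (𝕜 := ℂ), hinner, hmeas]
    ring

theorem scalarMeasure_add (hB : MeasurableSet B) {y z : H} (hy : E.proj B y = y)
    (hz : E.proj B z = 0) :
    E.scalarMeasure (y + z) = E.scalarMeasure y + E.scalarMeasure z := by
  ext C hC
  have horth : ⟪E.proj C y, E.proj C z⟫_ℂ = 0 := by
    rw [← hy, E.proj_proj y hC hB, Set.inter_comm, ← E.proj_proj y hB hC, E.inner_proj_left _ hB,
      E.proj_proj z hB hC, Set.inter_comm, ← E.proj_proj z hC hB, hz, map_zero, inner_zero_right]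
  rw [Measure.add_apply, E.scalarMeasure_apply _ hC, E.scalarMeasure_apply _ hC,
    E.scalarMeasure_apply _ hC, ← ENNReal.ofReal_add (by positivity) (by positivity), map_add,
    sq, sq, sq, norm_add_sq_eq_norm_sq_add_norm_sq_of_inner_eq_zero _ _ horth]

theorem hasSum_proj_fiber {g : α → ℕ} (hg : Measurable g) :
    HasSum (fun n => E.proj (g ⁻¹' {n}) x) x := by
  have h := E.hasSum_proj (fun n => g ⁻¹' {n}) (fun n => hg (measurableSet_singleton n))
    (fun i j hij => Disjoint.preimage g (by simpa using hij)) x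
  rwa [← Set.preimage_iUnion, Set.iUnion_of_singleton, Set.preimage_univ, E.proj_univ] at h

end Projections

/-- The spectral subspace `ran E(B)`, described as the vectors fixed by `E(B)`. -/
def range (E : ResolutionOfIdentity α H) (B : Set α) : Submodule ℂ H :=
  LinearMap.eqLocus (E.proj B : H →ₗ[ℂ] H) LinearMap.id

theorem mem_range {E : ResolutionOfIdentity α H} {B : Set α} {x : H} :
    x ∈ E.range B ↔ E.proj B x = x :=
  Iff.rfl

theorem mem_range_iff_ae {E : ResolutionOfIdentity α H} {B : Set α} (hB : MeasurableSet B) {x : H} :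
    x ∈ E.range B ↔ ∀ᵐ s ∂(E.scalarMeasure x), s ∈ B := by
  rw [mem_range, E.proj_eq_self_iff x hB, ← E.scalarMeasure_eq_zero_iff x hB.compl]
  rfl

theorem proj_mem_range (E : ResolutionOfIdentity α H) {B : Set α} (hB : MeasurableSet B) (x : H) :
    E.proj B x ∈ E.range B :=
  E.proj_self_apply x hB

theorem range_mono (E : ResolutionOfIdentity α H) {B C : Set α} (hB : MeasurableSet B)
    (hC : MeasurableSet C) (hBC : B ⊆ C) : E.range B ≤ E.range C := by
  intro x hx
  rw [mem_range] at hx ⊢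
  rw [← hx, E.proj_proj x hC hB, Set.inter_eq_right.2 hBC]

namespace IsSpectralIntegral

variable {E : ResolutionOfIdentity α H} {φ : α → ℂ} {T : H →ₗ.[ℂ] H} {B : Set α}

theorem integrable (hT : E.IsSpectralIntegral φ T) (x : T.domain) :
    Integrable φ (E.scalarMeasure x) :=
  ((hT.1 x).1 x.2).integrable one_le_two

theorem range_le_domain (hT : E.IsSpectralIntegral φ T) (hφ : Measurable φ)
    (hB : MeasurableSet B) {z : ℂ} {r : ℝ} (hr : ∀ s ∈ B, ‖φ s - z‖ ≤ r) :
    E.range B ≤ T.domain := by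
  intro x hx
  rw [hT.1, ← mem_range.1 hx, E.scalarMeasure_proj x hB]
  refine MemLp.of_bound hφ.aestronglyMeasurable (r + ‖z‖) ?_
  filter_upwards [ae_restrict_mem hB] with s hs
  linarith [hr s hs, norm_sub_norm_le (φ s) z]

theorem dense_domain (hT : E.IsSpectralIntegral φ T) (hφ : Measurable φ) :
    Dense (T.domain : Set H) := by
  intro x
  have hg : Measurable fun s => ⌊‖φ s‖⌋₊ := Nat.measurable_floor.comp hφ.norm
  refine (mem_closure_iff_seq_limit.2 ⟨_, fun n => ?_, (E.hasSum_proj_fiber x hg).tendsto_sum_nat⟩)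
  refine Submodule.sum_mem _ fun i _ => ?_
  have hB := hg (measurableSet_singleton i)
  refine hT.range_le_domain hφ hB (z := 0) (r := i + 1) (fun s hs => ?_) (E.proj_mem_range hB x)
  rw [sub_zero, ← show ⌊‖φ s‖⌋₊ = i from hs]
  exact (Nat.lt_floor_add_one _).le

theorem proj_mem_domain (hT : E.IsSpectralIntegral φ T) (hB : MeasurableSet B) {x : H}
    (hx : x ∈ T.domain) : E.proj B x ∈ T.domain := by
  rw [hT.1, E.scalarMeasure_proj x hB]
  exact ((hT.1 x).1 hx).mono_measure Measure.restrict_le_self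

theorem inner_apply_eq_zero (hT : E.IsSpectralIntegral φ T) (hB : MeasurableSet B)
    {y z : T.domain} (hy : E.proj B y = y) (hz : E.proj B z = 0) : ⟪(z : H), T y⟫_ℂ = 0 := by
  refine inner_apply_eq_zero_of_quadratic_additive T.toFun fun a => ?_
  have haz : E.proj B (a • z : T.domain) = 0 := by
    rw [Submodule.coe_smul, map_smul, hz, smul_zero]
  have hadd := E.scalarMeasure_add hB hy haz
  have h := hT.2 (y + a • z)
  rw [Submodule.coe_add, hadd, integral_add_measure (hT.integrable y) (hT.integrable _), ← hT.2,
    ← hT.2] at h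
  exact h

theorem apply_mem_range (hT : E.IsSpectralIntegral φ T) (hφ : Measurable φ)
    (hB : MeasurableSet B) {y : T.domain} (hy : (y : H) ∈ E.range B) : T y ∈ E.range B := by
  rw [mem_range, E.proj_eq_self_iff _ hB]
  refine (hT.dense_domain hφ).eq_zero_of_inner_right ℂ fun v hv => ?_
  have hz : E.proj B (E.proj Bᶜ v) = 0 := by
    rw [← E.scalarMeasure_eq_zero_iff _ hB, E.scalarMeasure_proj _ hB.compl,
      Measure.restrict_apply hB, Set.inter_compl_self, measure_empty]
  rw [← E.inner_proj_left _ hB.compl]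
  exact hT.inner_apply_eq_zero hB (z := ⟨_, hT.proj_mem_domain hB.compl hv⟩) hy hz

theorem norm_inner_apply_sub_le (hT : E.IsSpectralIntegral φ T) (hB : MeasurableSet B) {z : ℂ}
    {r : ℝ} (hr : ∀ s ∈ B, ‖φ s - z‖ ≤ r) {y : T.domain} (hy : (y : H) ∈ E.range B) :
    ‖⟪(y : H), T y - z • (y : H)⟫_ℂ‖ ≤ r * ‖(y : H)‖ ^ 2 := by
  have hinner : ⟪(y : H), T y - z • (y : H)⟫_ℂ = ∫ s, (φ s - z) ∂(E.scalarMeasure y) := by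
    rw [integral_sub (hT.integrable y) (integrable_const _), ← hT.2, inner_sub_right,
      inner_smul_right, integral_const, measureReal_scalarMeasure_univ, inner_self_eq_norm_sq_to_K,
      Complex.real_smul, mul_comm z]
    norm_cast
  rw [hinner, ← measureReal_scalarMeasure_univ E]
  exact norm_integral_le_of_norm_le_const (((mem_range_iff_ae hB).1 hy).mono hr)

/-- The restriction of `∫ φ dE` to a spectral subspace `ran E(B)` on which `φ` is bounded. -/
def restrict (hT : E.IsSpectralIntegral φ T) (hφ : Measurable φ) (hB : MeasurableSet B) {z : ℂ}
    {r : ℝ} (hr : ∀ s ∈ B, ‖φ s - z‖ ≤ r) : E.range B →ₗ[ℂ] E.range B :=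
  (T.toFun ∘ₗ Submodule.inclusion (hT.range_le_domain hφ hB hr)).codRestrict (E.range B)
    fun y => hT.apply_mem_range hφ hB y.2

theorem norm_restrict_sub_pow_apply_le (hT : E.IsSpectralIntegral φ T) (hφ : Measurable φ)
    (hB : MeasurableSet B) {z : ℂ} {r : ℝ} (hr₀ : 0 ≤ r)
    (hr : ∀ s ∈ B, ‖φ s - z‖ ≤ r) (k : ℕ) (y : E.range B) :
    ‖((hT.restrict hφ hB hr - z • 1) ^ k) y‖ ≤ (2 * r) ^ k * ‖y‖ := by
  set R := hT.restrict hφ hB hr - z • 1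
  have hR (x : E.range B) : ‖R x‖ ≤ 2 * r * ‖x‖ := by
    refine norm_apply_le_of_norm_inner_apply_self_le R (fun y => ?_) x
    rw [norm_inner_symm]
    exact hT.norm_inner_apply_sub_le hB hr (y := ⟨y, hT.range_le_domain hφ hB hr y.2⟩) y.2
  induction k generalizing y with
  | zero => simp
  | succ k ih =>
    rw [pow_succ, Module.End.mul_apply]
    calc _ ≤ (2 * r) ^ k * ‖R y‖ := ih _
      _ ≤ (2 * r) ^ k * (2 * r * ‖y‖) := by gcongr; exact hR y
      _ = (2 * r) ^ (k + 1) * ‖y‖ := by ring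

theorem unique {F : ResolutionOfIdentity α H} {S : H →ₗ.[ℂ] H} (hT : E.IsSpectralIntegral φ T)
    (hS : F.IsSpectralIntegral φ S) (hφ : Measurable φ)
    (hEF : ∀ x, E.scalarMeasure x = F.scalarMeasure x) : T = S := by
  have hdom : T.domain = S.domain := by
    ext x
    rw [hT.1, hS.1, hEF]
  let D : T.domain →ₗ[ℂ] H := T.toFun - S.toFun ∘ₗ Submodule.inclusion hdom.le
  have hD (y : T.domain) : ⟪(y : H), D y⟫_ℂ = 0 := by
    have hy := hS.2 (Submodule.inclusion hdom.le y)
    rw [Submodule.coe_inclusion, ← hEF, ← hT.2] at hy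
    rw [LinearMap.sub_apply, inner_sub_right, sub_eq_zero]
    exact hy.symm
  refine LinearPMap.ext hdom fun x hxT hxS => ?_
  have hx : D ⟨x, hxT⟩ = 0 := by
    refine (hT.dense_domain hφ).eq_zero_of_inner_right ℂ fun v hv => ?_
    exact inner_apply_eq_zero_of_quadratic_additive D (z := ⟨v, hv⟩) fun a => by
      rw [hD, hD, hD, add_zero]
  exact sub_eq_zero.1 hx

end IsSpectralIntegral

end ResolutionOfIdentity

theorem measure_eq_of_isOpen_le {X : Type*} [TopologicalSpace X] [MeasurableSpace X]
    {μ ν : Measure X} [IsFiniteMeasure μ] [ν.OuterRegular]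
    (h : ∀ U, IsOpen U → μ U ≤ ν U) (huniv : μ Set.univ = ν Set.univ) : μ = ν := by
  refine Measure.eq_of_le_of_measure_univ_eq (Measure.le_iff'.2 fun s => ?_) huniv
  rw [s.measure_eq_iInf_isOpen ν]
  exact le_iInf₂ fun U hU => le_iInf fun hUo => (measure_mono hU).trans (h U hUo)

namespace ResolutionOfIdentity

section Comparison

variable {H : Type*} [NormedAddCommGroup H] [InnerProductSpace ℂ H] [CompleteSpace H]
  {X : Type*} [PseudoMetricSpace X] [SecondCountableTopology X] [MeasurableSpace X] [BorelSpace X]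
  {E F : ResolutionOfIdentity X H}

theorem proj_eq_zero_of_range_ball_le
    (h : ∀ s, ∀ r > 0, E.range (Metric.ball s r) ≤ F.range (Metric.closedBall s (2 * r)))
    {U : Set X} (hU : IsOpen U) {w : H} (hw : F.proj U w = 0) : E.proj U w = 0 := by
  rw [← E.scalarMeasure_eq_zero_iff w hU.measurableSet]
  refine measure_null_of_locally_null U fun s hs => ?_
  obtain ⟨ε, hε, hεU⟩ := Metric.nhds_basis_closedBall.mem_iff.1 (hU.mem_nhds hs)
  refine ⟨_, mem_nhdsWithin_of_mem_nhds (Metric.ball_mem_nhds s (half_pos hε)), ?_⟩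
  have hball : MeasurableSet (Metric.ball s (ε / 2)) := measurableSet_ball
  have hmem := h s _ (half_pos hε) (E.proj_mem_range hball w)
  rw [mul_div_cancel₀ _ two_ne_zero] at hmem
  have hmemU := F.range_mono measurableSet_closedBall hU.measurableSet hεU hmem
  rw [E.scalarMeasure_eq_zero_iff w hball, ← inner_self_eq_zero (𝕜 := ℂ)]
  calc ⟪E.proj (Metric.ball s (ε / 2)) w, E.proj (Metric.ball s (ε / 2)) w⟫_ℂ
      = ⟪F.proj U (E.proj (Metric.ball s (ε / 2)) w), w⟫_ℂ := by
        rw [mem_range.1 hmemU, ← E.inner_proj_left _ hball, E.proj_self_apply _ hball]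
    _ = 0 := by rw [F.inner_proj_left _ hU.measurableSet, hw, inner_zero_right]

theorem scalarMeasure_eq_of_range_ball_le
    (h : ∀ s, ∀ r > 0, E.range (Metric.ball s r) ≤ F.range (Metric.closedBall s (2 * r))) (x : H) :
    E.scalarMeasure x = F.scalarMeasure x := by
  refine measure_eq_of_isOpen_le (fun U hU => ?_) (by rw [scalarMeasure_univ, scalarMeasure_univ])
  have hUm := hU.measurableSet
  have hzero : E.proj U (x - F.proj U x) = 0 :=
    proj_eq_zero_of_range_ball_le h hU (by rw [map_sub, F.proj_self_apply x hUm, sub_self])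
  rw [map_sub, sub_eq_zero] at hzero
  rw [E.scalarMeasure_apply x hUm, F.scalarMeasure_apply x hUm, hzero]
  gcongr
  exact (E.proj U).le_of_opNorm_le_of_le (E.isStarProjection U hUm).norm_le le_rfl
    |>.trans_eq (one_mul _)

end Comparison

section Constructions

variable {α β : Type*} [MeasurableSpace α] [MeasurableSpace β] {H K : Type*}
  [NormedAddCommGroup H] [InnerProductSpace ℂ H] [CompleteSpace H]
  [NormedAddCommGroup K] [InnerProductSpace ℂ K] [CompleteSpace K]

/-- A multiplicative family of orthogonal projections is countably additive as soon as the
functions `B ↦ ‖P(B) x‖²` are restrictions of finite measures. -/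
noncomputable def ofMeasure (P : Set α → H →L[ℂ] H) (ν : H → Measure α)
    [∀ x, IsFiniteMeasure (ν x)] (hP : ∀ B, MeasurableSet B → IsStarProjection (P B))
    (hPuniv : P Set.univ = 1)
    (hPinter : ∀ B C, MeasurableSet B → MeasurableSet C → P (B ∩ C) = P B * P C)
    (hPν : ∀ B, MeasurableSet B → ∀ x, ‖P B x‖ ^ 2 = (ν x).real B) :
    ResolutionOfIdentity α H where
  proj := P
  isStarProjection := hP
  proj_univ := hPuniv
  proj_inter := hPinter
  hasSum_proj B hB hd x := by
    have hinner {C D : Set α} (hC : MeasurableSet C) (hD : MeasurableSet D) (y z : H) :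
        ⟪P C y, P D z⟫_ℂ = ⟪y, P (C ∩ D) z⟫_ℂ := by
      rw [hPinter C D hC hD]
      exact (hP C hC).isSelfAdjoint.isSymmetric y (P D z)
    have hinner_self {C D : Set α} (hC : MeasurableSet C) (hD : MeasurableSet D) :
        ⟪P C x, P D x⟫_ℂ = (((ν x).real (C ∩ D) : ℝ) : ℂ) := by
      have h := inner_self_eq_norm_sq_to_K (𝕜 := ℂ) (P (C ∩ D) x)
      rw [hinner (hC.inter hD) (hC.inter hD), Set.inter_self] at h
      rw [hinner hC hD, ← hPν _ (hC.inter hD), Complex.ofReal_pow]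
      exact h
    refine hasSum_of_orthogonal_of_hasSum_norm_sq (fun i j hij => ?_) (fun i => ?_) ?_
    · dsimp only
      rw [hinner_self (hB i) (hB j), (hd hij).inter_eq, measureReal_empty, Complex.ofReal_zero]
    · rw [hinner_self (hB i) (.iUnion hB), Set.inter_eq_left.2 (Set.subset_iUnion B i),
        ← Complex.ofReal_pow, hPν _ (hB i)]
    · simp only [hPν _ (hB _), hPν _ (MeasurableSet.iUnion hB)]
      have h := (ν x).toSignedMeasure.m_iUnion hB hd
      simpa only [Measure.toSignedMeasure_apply_measurable (hB _),
        Measure.toSignedMeasure_apply_measurable (MeasurableSet.iUnion hB)] using h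

/-- The image of a resolution of the identity under a measurable map. -/
noncomputable def map (E : ResolutionOfIdentity α H) {m : α → β} (hm : Measurable m) :
    ResolutionOfIdentity β H where
  proj B := E.proj (m ⁻¹' B)
  isStarProjection B hB := E.isStarProjection _ (hm hB)
  proj_univ := E.proj_univ
  proj_inter B C hB hC := E.proj_inter _ _ (hm hB) (hm hC)
  hasSum_proj B hB hd x := by
    rw [Set.preimage_iUnion]
    exact E.hasSum_proj _ (fun i => hm (hB i)) (fun i j hij => (hd hij).preimage m) x

theorem scalarMeasure_map (E : ResolutionOfIdentity α H) {m : α → β} (hm : Measurable m) (x : H) :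
    (E.map hm).scalarMeasure x = (E.scalarMeasure x).map m := by
  ext B hB
  rw [Measure.map_apply hm hB, scalarMeasure_apply _ _ hB, scalarMeasure_apply _ _ (hm hB)]
  rfl

/-- The transport of a resolution of the identity along a unitary map. -/
noncomputable def conj (E : ResolutionOfIdentity α K) (W : H ≃ₗᵢ[ℂ] K) :
    ResolutionOfIdentity α H where
  proj B := W.symm.conjStarAlgEquiv (E.proj B)
  isStarProjection B hB := (E.isStarProjection B hB).map W.symm.conjStarAlgEquiv
  proj_univ := by rw [E.proj_univ, map_one]
  proj_inter B C hB hC := by rw [E.proj_inter B C hB hC, map_mul]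
  hasSum_proj B hB hd x := (E.hasSum_proj B hB hd (W x)).mapL (W.symm : K →L[ℂ] H)

theorem scalarMeasure_conj (E : ResolutionOfIdentity α K) (W : H ≃ₗᵢ[ℂ] K) (x : H) :
    (E.conj W).scalarMeasure x = E.scalarMeasure (W x) := by
  ext B hB
  rw [scalarMeasure_apply _ _ hB, scalarMeasure_apply _ _ hB, ← W.symm.norm_map]
  rfl

end Constructions

end ResolutionOfIdentity

section SquareIntegrable

variable {X : Type*} [MeasurableSpace X] {μ : Measure X}

theorem ae_le_of_lintegral_pow_le {h : X → ℝ≥0∞} (hh : Measurable h) {r C : ℝ≥0∞} (hC : C ≠ ∞)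
    (hb : ∀ k : ℕ, ∫⁻ t, h t ^ k ∂μ ≤ r ^ k * C) : ∀ᵐ t ∂μ, h t ≤ r := by
  have hlt (q : ℚ) (hq : r < ENNReal.ofReal q) : ∀ᵐ t ∂μ, h t < ENNReal.ofReal q := by
    set b := ENNReal.ofReal q
    have hb0 : b ≠ 0 := (bot_le.trans_lt hq).ne'
    have hmeas (k : ℕ) : μ {t | b ≤ h t} ≤ (r / b) ^ k * C := by
      have hbk := pow_ne_zero k hb0
      have hbk' : b ^ k ≠ ∞ := by finiteness
      rw [div_eq_mul_inv, mul_pow, ← ENNReal.inv_pow, mul_right_comm, ← div_eq_mul_inv,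
        ENNReal.le_div_iff_mul_le (.inl hbk) (.inl hbk'), mul_comm]
      calc b ^ k * μ {t | b ≤ h t} ≤ b ^ k * μ {t | b ^ k ≤ h t ^ k} :=
            mul_le_mul_right (measure_mono fun t (ht : b ≤ h t) => pow_le_pow_left' ht k) _
        _ ≤ ∫⁻ t, h t ^ k ∂μ := mul_meas_ge_le_lintegral (hh.pow_const k) _
        _ ≤ r ^ k * C := hb k
    have hrb : r / b < 1 := ENNReal.div_lt_of_lt_mul (by rwa [one_mul])
    have hlim := ENNReal.Tendsto.mul_const (ENNReal.tendsto_pow_atTop_nhds_zero_of_lt_one hrb)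
      (.inr hC)
    rw [zero_mul] at hlim
    have hzero := le_antisymm (ge_of_tendsto' hlim hmeas) bot_le
    simpa only [ae_iff, not_lt] using hzero
  filter_upwards [ae_all_iff.2 fun q => eventually_imp_distrib_left.2 (hlt q)] with t ht
  by_contra! hrt
  obtain ⟨q, -, hrq, hqt⟩ := ENNReal.lt_iff_exists_rat_btwn.1 hrt
  exact (ht q hrq).not_gt hqt

/-- The finite measure `|f|² μ` attached to `f ∈ L²(μ)`. -/
noncomputable def normSqMeasure (f : Lp ℂ 2 μ) : Measure X :=
  μ.withDensity fun t => (‖f t‖₊ ^ 2 : NNReal)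

theorem measurable_nnnorm_sq (f : Lp ℂ 2 μ) : Measurable fun t => ‖f t‖₊ ^ 2 :=
  (Lp.stronglyMeasurable f).measurable.nnnorm.pow_const 2

theorem ofReal_norm_sq_eq_lintegral (f : Lp ℂ 2 μ) :
    ENNReal.ofReal (‖f‖ ^ 2) = ∫⁻ t, ‖f t‖ₑ ^ 2 ∂μ := by
  rw [Lp.norm_def, ← ENNReal.toReal_pow,
    ENNReal.ofReal_toReal (ENNReal.pow_ne_top (Lp.memLp f).2.ne),
    eLpNorm_eq_lintegral_rpow_enorm_toReal (by norm_num) (by norm_num), ENNReal.toReal_ofNat,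
    ← ENNReal.rpow_natCast, ← ENNReal.rpow_mul]
  norm_num

instance (f : Lp ℂ 2 μ) : IsFiniteMeasure (normSqMeasure f) := by
  refine isFiniteMeasure_withDensity ?_
  simp only [ENNReal.coe_pow, ← enorm_eq_nnnorm, ← ofReal_norm_sq_eq_lintegral]
  exact ENNReal.ofReal_ne_top

theorem memLp_two_normSqMeasure_iff {f : Lp ℂ 2 μ} {φ : X → ℂ} (hφ : Measurable φ) :
    MemLp φ 2 (normSqMeasure f) ↔ MemLp (fun t => φ t * f t) 2 μ := by
  rw [memLp_two_iff_integrable_sq_norm hφ.aestronglyMeasurable,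
    memLp_two_iff_integrable_sq_norm (f := fun t => φ t * f t)
      (hφ.aestronglyMeasurable.mul (Lp.aestronglyMeasurable f)), normSqMeasure,
    integrable_withDensity_iff_integrable_smul (measurable_nnnorm_sq f)]
  simp only [norm_mul, mul_pow, mul_comm, NNReal.smul_def, NNReal.coe_pow, coe_nnnorm, smul_eq_mul]

theorem integral_normSqMeasure (f : Lp ℂ 2 μ) (φ : X → ℂ) :
    ∫ t, φ t ∂(normSqMeasure f) = ∫ t, ⟪f t, φ t * f t⟫_ℂ ∂μ := by
  rw [normSqMeasure, integral_withDensity_eq_integral_smul (measurable_nnnorm_sq f)]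
  congr with t
  rw [RCLike.inner_apply, mul_assoc, RCLike.mul_conj, NNReal.smul_def]
  simp [mul_comm]

open Classical in
/-- Multiplication by the indicator function of a measurable set `S` on `L²(μ)`; it is `0` if `S`
is not measurable. -/
noncomputable def indicatorL2 (μ : Measure X) (S : Set X) : Lp ℂ 2 μ →L[ℂ] Lp ℂ 2 μ :=
  (ContinuousLinearMap.lsmul ℂ ℂ).holderL μ ∞ 2 2
    (if hS : MeasurableSet S then ((memLp_top_const (1 : ℂ)).indicator hS).toLp _ else 0)

theorem coeFn_indicatorL2 {S : Set X} (hS : MeasurableSet S) (f : Lp ℂ 2 μ) :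
    indicatorL2 μ S f =ᵐ[μ] S.indicator f := by
  have hone := ((memLp_top_const (μ := μ) (1 : ℂ)).indicator hS).coeFn_toLp
  rw [indicatorL2, dif_pos hS]
  refine ((ContinuousLinearMap.lsmul ℂ ℂ).coeFn_holder (r := 2) _ f).trans ?_
  filter_upwards [hone] with t ht
  rw [ht]
  by_cases hSt : t ∈ S <;> simp [hSt]

theorem norm_indicatorL2_sq {S : Set X} (hS : MeasurableSet S) (f : Lp ℂ 2 μ) :
    ‖indicatorL2 μ S f‖ ^ 2 = (normSqMeasure f).real S := by
  rw [measureReal_def, normSqMeasure, withDensity_apply _ hS, ← lintegral_indicator hS,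
    ← ENNReal.toReal_ofReal (sq_nonneg ‖indicatorL2 μ S f‖), ofReal_norm_sq_eq_lintegral]
  congr 1
  refine lintegral_congr_ae ?_
  filter_upwards [coeFn_indicatorL2 hS f] with t ht
  rw [ht]
  by_cases hSt : t ∈ S <;> simp [hSt, enorm_eq_nnnorm]

theorem indicatorL2_univ : indicatorL2 μ Set.univ = 1 := by
  ext1 f
  refine Lp.ext ?_
  filter_upwards [coeFn_indicatorL2 MeasurableSet.univ f] with t ht
  rw [ht, Set.indicator_univ]
  rfl

theorem indicatorL2_inter {S T : Set X} (hS : MeasurableSet S) (hT : MeasurableSet T) :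
    indicatorL2 μ (S ∩ T) = indicatorL2 μ S * indicatorL2 μ T := by
  ext1 f
  refine Lp.ext ?_
  filter_upwards [coeFn_indicatorL2 (hS.inter hT) f, coeFn_indicatorL2 hT f,
    coeFn_indicatorL2 hS (indicatorL2 μ T f)] with t hST hTt hSt
  rw [hST, mul_apply_eq_comp, hSt, ← Set.indicator_indicator]
  by_cases ht : t ∈ S <;> simp [ht, hTt]

theorem isStarProjection_indicatorL2 {S : Set X} (hS : MeasurableSet S) :
    IsStarProjection (indicatorL2 μ S) := by
  refine ⟨by rw [IsIdempotentElem, ← indicatorL2_inter hS hS, Set.inter_self],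
    ContinuousLinearMap.isSelfAdjoint_iff_isSymmetric.2 fun f g => ?_⟩
  rw [L2.inner_def, L2.inner_def]
  refine integral_congr_ae ?_
  filter_upwards [coeFn_indicatorL2 hS f, coeFn_indicatorL2 hS g] with t hf hg
  rw [ContinuousLinearMap.coe_coe, hf, hg]
  by_cases ht : t ∈ S <;> simp [ht]

/-- The resolution of the identity of `L²(μ)` by multiplication with indicator functions. -/
noncomputable def indicatorResolution (μ : Measure X) : ResolutionOfIdentity X (Lp ℂ 2 μ) :=
  .ofMeasure (indicatorL2 μ) normSqMeasure (fun _ => isStarProjection_indicatorL2)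
    indicatorL2_univ (fun _ _ => indicatorL2_inter) (fun _ => norm_indicatorL2_sq)

theorem scalarMeasure_indicatorResolution (f : Lp ℂ 2 μ) :
    (indicatorResolution μ).scalarMeasure f = normSqMeasure f := by
  ext S hS
  rw [ResolutionOfIdentity.scalarMeasure_apply _ _ hS, ← ofReal_measureReal]
  exact congrArg ENNReal.ofReal (norm_indicatorL2_sq hS f)

end SquareIntegrable

section Diagonalization

variable {X : Type*} [MeasurableSpace X] {μ : Measure X} {H : Type*} [NormedAddCommGroup H]
  [InnerProductSpace ℂ H] {W : H ≃ₗᵢ[ℂ] Lp ℂ 2 μ} {m : X → ℂ} {A T : H →ₗ.[ℂ] H}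

/-- The spectral measure of the operator which `W` carries to multiplication by `m`: the projection
attached to `B` is carried to multiplication by the indicator function of `m ⁻¹' B`. -/
noncomputable def multiplicationResolution [CompleteSpace H] (W : H ≃ₗᵢ[ℂ] Lp ℂ 2 μ)
    (hm : Measurable m) : ResolutionOfIdentity ℂ H :=
  ((indicatorResolution μ).map hm).conj W

theorem scalarMeasure_multiplicationResolution [CompleteSpace H] (W : H ≃ₗᵢ[ℂ] Lp ℂ 2 μ)
    (hm : Measurable m) (x : H) :
    (multiplicationResolution W hm).scalarMeasure x = (normSqMeasure (W x)).map m := by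
  rw [multiplicationResolution, ResolutionOfIdentity.scalarMeasure_conj,
    ResolutionOfIdentity.scalarMeasure_map, scalarMeasure_indicatorResolution]

/-- The unitary map `W` carries the operator `A` to multiplication by `m` on its maximal domain. -/
def Diagonalizes (W : H ≃ₗᵢ[ℂ] Lp ℂ 2 μ) (m : X → ℂ) (A : H →ₗ.[ℂ] H) : Prop :=
  ∀ x y, (x, y) ∈ A.graph ↔ W y =ᵐ[μ] fun t => m t * W x t

theorem diagonalizes_boundedAsPartial {B : H →L[ℂ] H}
    (hB : ∀ x, W (B x) =ᵐ[μ] fun t => m t * W x t) : Diagonalizes W m (boundedAsPartial B) := by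
  intro x y
  have hgraph : (x, y) ∈ (boundedAsPartial B).graph ↔ B x = y := by
    rw [LinearPMap.mem_graph_iff]
    exact ⟨fun ⟨u, hux, huy⟩ => (congrArg B hux).symm.trans huy,
      fun h => ⟨⟨x, Submodule.mem_top⟩, rfl, h⟩⟩
  rw [hgraph, ← W.injective.eq_iff, Lp.ext_iff]
  exact ⟨fun h => h.symm.trans (hB x), fun h => (hB x).trans h.symm⟩

namespace Diagonalizes

theorem mem_domain_iff (hA : Diagonalizes W m A) (hm : Measurable m) (x : H) :
    x ∈ A.domain ↔ MemLp m 2 (normSqMeasure (W x)) := by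
  rw [memLp_two_normSqMeasure_iff hm, LinearPMap.mem_domain_iff]
  constructor
  · rintro ⟨y, hy⟩
    exact (memLp_congr_ae ((hA x y).1 hy)).1 (Lp.memLp (W y))
  · intro h
    exact ⟨W.symm (h.toLp _), (hA x _).2 (by rw [W.apply_symm_apply]; exact h.coeFn_toLp)⟩

theorem ae_apply (hA : Diagonalizes W m A) (x : A.domain) :
    W (A x) =ᵐ[μ] fun t => m t * W x t :=
  (hA x (A x)).1 (A.mem_graph x)

variable [CompleteSpace H] {E : ResolutionOfIdentity ℂ H}

theorem isSpectralIntegral {φ : ℂ → ℂ} (hT : Diagonalizes W (fun t => φ (m t)) T)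
    (hm : Measurable m) (hφ : Measurable φ) :
    (multiplicationResolution W hm).IsSpectralIntegral φ T := by
  refine ⟨fun x => ?_, fun x => ?_⟩
  · rw [scalarMeasure_multiplicationResolution,
      memLp_map_measure_iff hφ.aestronglyMeasurable hm.aemeasurable]
    exact hT.mem_domain_iff (hφ.comp hm) x
  · rw [scalarMeasure_multiplicationResolution, integral_map hm.aemeasurable
      hφ.aestronglyMeasurable, integral_normSqMeasure, ← W.inner_map_map, L2.inner_def]
    exact integral_congr_ae ((hT.ae_apply x).mono fun t ht => congrArg (inner ℂ (W x t)) ht)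

theorem ae_restrict_sub_pow_apply (hA : Diagonalizes W m A)
    (hE : E.IsSpectralIntegral (fun s => s) A) {B : Set ℂ} (hB : MeasurableSet B) {z : ℂ} {r : ℝ}
    (hr : ∀ s ∈ B, ‖s - z‖ ≤ r) (k : ℕ) (y : E.range B) :
    W (((hE.restrict measurable_id hB hr - z • 1) ^ k) y : E.range B) =ᵐ[μ]
      fun t => (m t - z) ^ k * W y t := by
  induction k with
  | zero => simp
  | succ k ih =>
    set u := ((hE.restrict measurable_id hB hr - z • 1) ^ k) y
    have hu : ((((hE.restrict measurable_id hB hr - z • 1) ^ (k + 1)) y : E.range B) : H)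
        = A (Submodule.inclusion (hE.range_le_domain measurable_id hB hr) u) - z • (u : H) := by
      rw [pow_succ', Module.End.mul_apply]
      rfl
    rw [hu, map_sub, map_smul]
    filter_upwards [Lp.coeFn_sub (W (A (Submodule.inclusion _ u))) (z • W u),
      Lp.coeFn_smul z (W u), hA.ae_apply (Submodule.inclusion _ u), ih] with t hsub hsmul hAt hut
    rw [hsub, Pi.sub_apply, hsmul, Pi.smul_apply, hAt, Submodule.coe_inclusion, hut, smul_eq_mul]
    ring

theorem lintegral_enorm_sub_sq_pow_le (hA : Diagonalizes W m A) (hm : Measurable m)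
    (hE : E.IsSpectralIntegral (fun s => s) A) {B : Set ℂ} (hB : MeasurableSet B) {z : ℂ} {r : ℝ}
    (hr₀ : 0 ≤ r) (hr : ∀ s ∈ B, ‖s - z‖ ≤ r) (k : ℕ) (y : E.range B) :
    ∫⁻ t, (‖m t - z‖ₑ ^ 2) ^ k ∂(normSqMeasure (W y)) ≤
      (ENNReal.ofReal (2 * r) ^ 2) ^ k * ENNReal.ofReal (‖y‖ ^ 2) := by
  set u := ((hE.restrict measurable_id hB hr - z • 1) ^ k) y
  have hu : ‖u‖ ≤ (2 * r) ^ k * ‖y‖ :=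
    hE.norm_restrict_sub_pow_apply_le measurable_id hB hr₀ hr k y
  calc ∫⁻ t, (‖m t - z‖ₑ ^ 2) ^ k ∂(normSqMeasure (W y))
      = ∫⁻ t, ‖W u t‖ₑ ^ 2 ∂μ := by
        rw [normSqMeasure, lintegral_withDensity_eq_lintegral_mul _
          (measurable_nnnorm_sq _).coe_nnreal_ennreal (by fun_prop)]
        refine lintegral_congr_ae ?_
        filter_upwards [hA.ae_restrict_sub_pow_apply hE hB hr k y] with t ht
        rw [ht, Pi.mul_apply, enorm_mul, enorm_pow, ENNReal.coe_pow, ← enorm_eq_nnnorm]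
        ring
    _ = ENNReal.ofReal (‖u‖ ^ 2) := by
        rw [← ofReal_norm_sq_eq_lintegral, W.norm_map, Submodule.coe_norm]
    _ ≤ ENNReal.ofReal (((2 * r) ^ k * ‖y‖) ^ 2) := by gcongr
    _ = _ := by
        rw [mul_pow, ← pow_mul, mul_comm k, pow_mul, ENNReal.ofReal_mul (by positivity),
          ENNReal.ofReal_pow (by positivity), ENNReal.ofReal_pow (by positivity)]

theorem range_ball_le (hA : Diagonalizes W m A) (hm : Measurable m)
    (hE : E.IsSpectralIntegral (fun s => s) A) (z : ℂ) {r : ℝ} (hr : 0 < r) :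
    E.range (Metric.ball z r) ≤
      (multiplicationResolution W hm).range (Metric.closedBall z (2 * r)) := by
  intro y hy
  have hgrowth (k : ℕ) : ∫⁻ t, (‖m t - z‖ₑ ^ 2) ^ k ∂(normSqMeasure (W y)) ≤
      (ENNReal.ofReal (2 * r) ^ 2) ^ k * ENNReal.ofReal (‖y‖ ^ 2) :=
    hA.lintegral_enorm_sub_sq_pow_le hm hE measurableSet_ball hr.le
      (fun _ hs => (mem_ball_iff_norm.1 hs).le) k ⟨y, hy⟩
  have hle := ae_le_of_lintegral_pow_le (by fun_prop) ENNReal.ofReal_ne_top hgrowth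
  rw [ResolutionOfIdentity.mem_range_iff_ae measurableSet_closedBall,
    scalarMeasure_multiplicationResolution,
    ae_map_iff hm.aemeasurable (p := fun s => s ∈ Metric.closedBall z (2 * r))
      measurableSet_closedBall]
  filter_upwards [hle] with t ht
  rw [mem_closedBall_iff_norm]
  rwa [ENNReal.pow_le_pow_left_iff two_ne_zero, ← ofReal_norm,
    ENNReal.ofReal_le_ofReal_iff (by positivity)] at ht

theorem functionOfOperator_eq {φ : ℂ → ℂ} (hA : Diagonalizes W m A)
    (hT : Diagonalizes W (fun t => φ (m t)) T) (hm : Measurable m) (hφ : Measurable φ) :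
    functionOfOperator A φ = T := by
  have hFA : (multiplicationResolution W hm).IsSpectralIntegral (fun s => s) A :=
    isSpectralIntegral hA hm measurable_id
  have hFT := hT.isSpectralIntegral hm hφ
  have hex : ∃ S : H →ₗ.[ℂ] H, ∃ E : ResolutionOfIdentity ℂ H,
      E.IsSpectralIntegral (fun s => s) A ∧ E.IsSpectralIntegral φ S := ⟨T, _, hFA, hFT⟩
  rw [functionOfOperator, dif_pos hex]
  obtain ⟨E, hEA, hES⟩ := hex.choose_spec
  exact hES.unique hFT hφ <| ResolutionOfIdentity.scalarMeasure_eq_of_range_ball_le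
    fun z r hr => hA.range_ball_le hm hEA z hr

end Diagonalizes

end Diagonalization

open SchwartzMap FourierTransform
open scoped ContDiff

section AbsoluteContinuity

theorem absolutelyContinuousOnInterval_of_dist_le {α β : Type*} [PseudoMetricSpace α]
    [PseudoMetricSpace β] {f : ℝ → α} {g : ℝ → β} {a b : ℝ}
    (hg : AbsolutelyContinuousOnInterval g a b) (h : ∀ x y, dist (f x) (f y) ≤ dist (g x) (g y)) :
    AbsolutelyContinuousOnInterval f a b := by
  rw [AbsolutelyContinuousOnInterval] at hg ⊢
  exact squeeze_zero (fun _ => Finset.sum_nonneg fun _ _ => dist_nonneg)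
    (fun _ => Finset.sum_le_sum fun _ _ => h _ _) hg

theorem continuous_of_forall_absolutelyContinuousOnInterval {F : Type*} [SeminormedAddCommGroup F]
    {f : ℝ → F} (hf : ∀ a b, AbsolutelyContinuousOnInterval f a b) : Continuous f := by
  refine continuous_iff_continuousAt.2 fun t =>
    (hf (t - 1) (t + 1)).continuousOn.continuousAt ?_
  rw [Set.uIcc_of_le (by linarith)]
  exact Icc_mem_nhds (by linarith) (by linarith)

variable {E : Type*} [NormedAddCommGroup E] [NormedSpace ℝ E] {f g : ℝ → E}

theorem absolutelyContinuousOnInterval_primitive (hf : LocallyIntegrable f volume) (c a b : ℝ) :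
    AbsolutelyContinuousOnInterval (fun x => ∫ t in c..x, f t) a b := by
  have hi (x y : ℝ) : IntervalIntegrable f volume x y :=
    (hf.integrableOn_isCompact isCompact_uIcc).intervalIntegrable
  have hac : AbsolutelyContinuousOnInterval (fun x => ∫ t in c..x, ‖f t‖)
      (min c (min a b)) (max c (max a b)) := by
    refine (hi _ _).norm.absolutelyContinuousOnInterval_intervalIntegral ?_
    exact Set.mem_uIcc_of_le (min_le_left _ _) (le_max_left _ _)
  refine absolutelyContinuousOnInterval_of_dist_le (hac.mono ?_) fun x y => ?_
  · exact Set.Icc_subset_uIcc.trans' (Set.Icc_subset_Icc (min_le_right _ _) (le_max_right _ _))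
  · rw [dist_eq_norm, dist_eq_norm, intervalIntegral.integral_interval_sub_left (hi c x) (hi c y),
      intervalIntegral.integral_interval_sub_left (hi c x).norm (hi c y).norm]
    exact intervalIntegral.norm_integral_le_abs_integral_norm

variable [CompleteSpace E]

theorem integral_eq_sub_of_absolutelyContinuous
    (hf : ∀ a b, AbsolutelyContinuousOnInterval f a b) (hg : LocallyIntegrable g volume)
    (hfg : ∀ᵐ t, HasDerivAt f (g t) t) (a b : ℝ) : ∫ t in a..b, g t = f b - f a := by
  have hzero : ∀ᵐ t, t ∈ Set.uIcc a b → HasDerivAt (f - fun x => ∫ s in a..x, g s) 0 t := by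
    filter_upwards [hfg, LocallyIntegrable.ae_hasDerivAt_integral hg] with t hft hgt _
    rw [← sub_self (g t)]
    exact hft.sub (hgt a)
  obtain ⟨C, hC⟩ := ((hf a b).sub
    (absolutelyContinuousOnInterval_primitive hg a a b)).const_of_ae_hasDerivAt_zero hzero
  have hCa := hC a Set.left_mem_uIcc
  have hCb := hC b Set.right_mem_uIcc
  rw [Pi.sub_apply, intervalIntegral.integral_same, sub_zero] at hCa
  rw [Pi.sub_apply, ← hCa] at hCb
  rw [← sub_sub_cancel (f b) (∫ t in a..b, g t), hCb]

theorem integral_eq_zero_of_absolutelyContinuous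
    (hf : ∀ a b, AbsolutelyContinuousOnInterval f a b) (hfi : Integrable f) (hg : Integrable g)
    (hfg : ∀ᵐ t, HasDerivAt f (g t) t) : ∫ t, g t = 0 := by
  have hftc := integral_eq_sub_of_absolutelyContinuous hf hg.locallyIntegrable hfg
  -- The limits of `f` at `±∞` exist, and they vanish because `f` is integrable.
  have htop : f 0 + ∫ t in Set.Ioi 0, g t = 0 := by
    refine IntegrableAtFilter.eq_zero_of_tendsto (hfi.integrableAtFilter atTop) (fun s hs => ?_)
      (((intervalIntegral_tendsto_integral_Ioi 0 hg.integrableOn tendsto_id).const_add _).congr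
        fun x => by rw [hftc, id, add_sub_cancel])
    obtain ⟨b, hb⟩ := mem_atTop_sets.1 hs
    exact measure_mono_top hb Real.volume_Ici
  have hbot : f 0 - ∫ t in Set.Iic 0, g t = 0 := by
    refine IntegrableAtFilter.eq_zero_of_tendsto (hfi.integrableAtFilter atBot) (fun s hs => ?_)
      (((intervalIntegral_tendsto_integral_Iic 0 hg.integrableOn tendsto_id).const_sub _).congr
        fun x => by rw [hftc, id, sub_sub_cancel])
    obtain ⟨b, hb⟩ := mem_atBot_sets.1 hs
    exact measure_mono_top hb Real.volume_Iic
  rw [← intervalIntegral.integral_Iic_add_Ioi hg.integrableOn hg.integrableOn (b := 0),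
    ← sub_eq_zero.1 hbot, htop]

theorem exists_hasCompactSupport_deriv_eq {p : ℝ → ℝ} (hp : ContDiff ℝ ∞ p)
    (hs : HasCompactSupport p) (h0 : ∫ t, p t = 0) :
    ∃ φ : ℝ → ℝ, ContDiff ℝ ∞ φ ∧ HasCompactSupport φ ∧ deriv φ = p := by
  obtain ⟨r, hr⟩ := hs.isBounded.subset_closedBall 0
  set R := r + 1
  have hz (t : ℝ) (ht : t ∉ Set.Ioc (-R) R) : p t = 0 :=
    image_eq_zero_of_notMem_tsupport fun h => ht (by
      have htr := hr h
      rw [Real.closedBall_eq_Icc, zero_sub, zero_add] at htr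
      exact ⟨by linarith [htr.1], by linarith [htr.2]⟩)
  have hd (t : ℝ) : HasDerivAt (fun x => ∫ s in (-R)..x, p s) (p t) t :=
    hp.continuous.integral_hasStrictDerivAt (-R) t |>.hasDerivAt
  have hderiv : deriv (fun x => ∫ s in (-R)..x, p s) = p := funext fun t => (hd t).deriv
  refine ⟨fun x => ∫ s in (-R)..x, p s, ?_, ?_, hderiv⟩
  · rw [contDiff_infty_iff_deriv, hderiv]
    exact ⟨fun t => (hd t).differentiableAt, hp⟩
  · refine HasCompactSupport.intro (isCompact_Icc (a := -R) (b := R)) fun x hx => ?_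
    rw [Set.mem_Icc, not_and_or, not_le, not_le] at hx
    rcases hx with hx | hx
    · rw [intervalIntegral.integral_symm, neg_eq_zero]
      refine intervalIntegral.integral_zero_ae (.of_forall fun t ht => ?_)
      rw [Set.uIoc_of_le hx.le] at ht
      exact hz t fun h => (h.1.trans_le ht.2).false
    · rw [← h0]
      refine intervalIntegral.integral_eq_integral_of_support_subset fun t ht => ?_
      by_contra hn
      exact ht (hz t fun h => hn ⟨h.1, h.2.trans hx.le⟩)

theorem exists_ae_eq_const_of_integral_deriv_smul_eq_zero (hf : LocallyIntegrable f volume)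
    (h : ∀ φ : ℝ → ℝ, ContDiff ℝ ∞ φ → HasCompactSupport φ → ∫ t, deriv φ t • f t = 0) :
    ∃ C, f =ᵐ[volume] fun _ => C := by
  let η : ℝ → ℝ := (default : ContDiffBump (0 : ℝ)).normed volume
  have hηs : ContDiff ℝ ∞ η := ContDiffBump.contDiff_normed _
  have hηc : HasCompactSupport η := ContDiffBump.hasCompactSupport_normed _
  have hηi : ∫ t, η t = 1 := ContDiffBump.integral_normed _
  refine ⟨∫ t, η t • f t, ae_eq_of_integral_contDiff_smul_eq hf (locallyIntegrable_const _)
    fun ψ hψ hψc => ?_⟩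
  have hψi : Integrable ψ := hψ.continuous.integrable_of_hasCompactSupport hψc
  -- `ψ - (∫ ψ) η` has mean zero, hence is the derivative of a test function.
  obtain ⟨φ, hφ, hφc, hφd⟩ := exists_hasCompactSupport_deriv_eq
    (p := fun t => ψ t - (∫ s, ψ s) * η t) (by fun_prop) (hψc.sub hηc.mul_left) (by
      rw [integral_sub hψi ((hηs.continuous.integrable_of_hasCompactSupport hηc).const_mul _),
        integral_const_mul, hηi, mul_one, sub_self])
  have hzero := h φ hφ hφc
  simp only [hφd, sub_smul, mul_smul] at hzero
  rw [integral_sub (hf.integrable_smul_left_of_hasCompactSupport hψ.continuous hψc)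
    ((hf.integrable_smul_left_of_hasCompactSupport hηs.continuous hηc).fun_smul (∫ s, ψ s)),
    integral_smul, sub_eq_zero] at hzero
  rw [hzero, integral_smul_const]

end AbsoluteContinuity

section WeakDerivative

variable {f g u v : ℝ → ℂ}

/-- `f` agrees almost everywhere with a locally absolutely continuous function whose derivative is
almost everywhere equal to `g`. -/
def HasSobolevDeriv (f g : ℝ → ℂ) : Prop :=
  ∃ F : ℝ → ℂ, f =ᵐ[volume] F ∧ (∀ a b, AbsolutelyContinuousOnInterval F a b) ∧
    ∀ᵐ t, HasDerivAt F (g t) t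

/-- `g` is the derivative of `f` in the sense of tempered distributions. -/
def IsWeakDeriv (f g : ℝ → ℂ) : Prop :=
  ∀ ψ : 𝓢(ℝ, ℂ), ∫ t, ψ t * g t = -∫ t, deriv ψ t * f t

theorem hasSobolevDeriv_primitive (hg : LocallyIntegrable g volume) :
    HasSobolevDeriv (fun x => ∫ t in (0 : ℝ)..x, g t) g :=
  ⟨_, .rfl, absolutelyContinuousOnInterval_primitive hg 0,
    (LocallyIntegrable.ae_hasDerivAt_integral hg).mono fun _ ht => ht 0⟩

namespace HasSobolevDeriv

theorem congr_ae (h : HasSobolevDeriv f g) (hf : u =ᵐ[volume] f) (hg : v =ᵐ[volume] g) :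
    HasSobolevDeriv u v := by
  obtain ⟨F, hfF, hF, hFg⟩ := h
  refine ⟨F, hf.trans hfF, hF, ?_⟩
  filter_upwards [hFg, hg] with t hFt hgt
  rwa [hgt]

theorem add_const (h : HasSobolevDeriv f g) (C : ℂ) : HasSobolevDeriv (fun t => f t + C) g := by
  obtain ⟨F, hfF, hF, hFg⟩ := h
  exact ⟨fun t => F t + C, hfF.add .rfl, fun a b => (hF a b).add
    (contDiff_const (c := C)).contDiffOn.absolutelyContinuousOnInterval,
    hFg.mono fun t ht => ht.add_const C⟩

theorem contDiff_mul (h : HasSobolevDeriv f g) {w : ℝ → ℂ} (hw : ContDiff ℝ 1 w) :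
    HasSobolevDeriv (fun t => w t * f t) (fun t => deriv w t * f t + w t * g t) := by
  obtain ⟨F, hfF, hF, hFg⟩ := h
  refine ⟨fun t => w t * F t, .mul .rfl hfF,
    fun a b => (hw.contDiffOn.absolutelyContinuousOnInterval).smul (hF a b), ?_⟩
  filter_upwards [hfF, hFg] with t hft hFt
  rw [hft]
  exact (hw.differentiable_one t).hasDerivAt.mul hFt

theorem integral_eq_zero (h : HasSobolevDeriv f g) (hf : Integrable f) (hg : Integrable g) :
    ∫ t, g t = 0 := by
  obtain ⟨F, hfF, hF, hFg⟩ := h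
  exact integral_eq_zero_of_absolutelyContinuous hF (hf.congr hfF) hg hFg

theorem isWeakDeriv (h : HasSobolevDeriv f g) (hf : MemLp f 2 volume) (hg : MemLp g 2 volume) :
    IsWeakDeriv f g := by
  intro ψ
  have hf' : Integrable fun t => deriv ψ t * f t :=
    ((derivCLM ℂ ℂ ψ).memLp 2 volume).integrable_mul hf
  have hg' : Integrable fun t => ψ t * g t := (ψ.memLp 2 volume).integrable_mul hg
  have hzero := (h.contDiff_mul (ψ.smooth 1)).integral_eq_zero
    ((ψ.memLp 2 volume).integrable_mul hf) (hf'.add hg')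
  rw [integral_add hf' hg'] at hzero
  exact eq_neg_of_add_eq_zero_right hzero

end HasSobolevDeriv

theorem hasSobolevDeriv_congr_ae (hf : u =ᵐ[volume] f) (hg : v =ᵐ[volume] g) :
    HasSobolevDeriv u v ↔ HasSobolevDeriv f g :=
  ⟨fun h => h.congr_ae hf.symm hg.symm, fun h => h.congr_ae hf hg⟩

theorem IsWeakDeriv.integral_deriv_smul_sub_eq_zero (h : IsWeakDeriv f g)
    (hf : LocallyIntegrable f volume) (hg : LocallyIntegrable g volume)
    (hu : HasSobolevDeriv u g) (hu' : Continuous u) {φ : ℝ → ℝ} (hφ : ContDiff ℝ ∞ φ)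
    (hφc : HasCompactSupport φ) : ∫ t, deriv φ t • (f t - u t) = 0 := by
  have hφ₁ : ContDiff ℝ 1 φ := hφ.of_le (by simp)
  have hderiv (t : ℝ) : deriv (fun s => (φ s : ℂ)) t = ((deriv φ t : ℝ) : ℂ) :=
    (hφ₁.differentiable_one t).hasDerivAt.ofReal_comp.deriv
  have hmul {w : ℝ → ℂ} (hw : LocallyIntegrable w volume) :
      Integrable fun t => (φ t : ℂ) * w t := by
    simpa only [Complex.real_smul] using
      hw.integrable_smul_left_of_hasCompactSupport hφ.continuous hφc
  have hmul_deriv {w : ℝ → ℂ} (hw : LocallyIntegrable w volume) :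
      Integrable fun t => ((deriv φ t : ℝ) : ℂ) * w t := by
    simpa only [Complex.real_smul] using
      hw.integrable_smul_left_of_hasCompactSupport (hφ₁.continuous_deriv le_rfl) hφc.deriv
  have hweak : ∫ t, (φ t : ℂ) * g t = -∫ t, ((deriv φ t : ℝ) : ℂ) * f t := by
    simp only [← hderiv]
    exact h ((hφc.comp_left (g := Complex.ofRealCLM) rfl).toSchwartzMap (by fun_prop))
  have hparts : ∫ t, ((deriv φ t : ℝ) : ℂ) * u t + φ t * g t = 0 := by
    simp only [← hderiv]
    have hsum := (hmul_deriv hu'.locallyIntegrable).add (hmul hg)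
    simp only [← hderiv] at hsum
    exact (hu.contDiff_mul (Complex.ofRealCLM.contDiff.comp hφ₁)).integral_eq_zero
      (hmul hu'.locallyIntegrable) hsum
  rw [integral_add (hmul_deriv hu'.locallyIntegrable) (hmul hg), hweak] at hparts
  simp only [Complex.real_smul, mul_sub]
  rw [integral_sub (hmul_deriv hf) (hmul_deriv hu'.locallyIntegrable)]
  linear_combination -hparts

theorem IsWeakDeriv.hasSobolevDeriv (h : IsWeakDeriv f g) (hf : LocallyIntegrable f volume)
    (hg : LocallyIntegrable g volume) : HasSobolevDeriv f g := by
  have hG := hasSobolevDeriv_primitive hg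
  have hcont : Continuous fun x => ∫ t in (0 : ℝ)..x, g t :=
    continuous_of_forall_absolutelyContinuousOnInterval
      (absolutelyContinuousOnInterval_primitive hg 0)
  obtain ⟨C, hC⟩ := exists_ae_eq_const_of_integral_deriv_smul_eq_zero
    (hf.sub hcont.locallyIntegrable)
    fun φ hφ hφc => h.integral_deriv_smul_sub_eq_zero hf hg hG hcont hφ hφc
  refine (hG.add_const C).congr_ae ?_ .rfl
  filter_upwards [hC] with t ht
  rw [← ht, Pi.sub_apply, add_sub_cancel]

theorem hasSobolevDeriv_iff_isWeakDeriv (hf : MemLp f 2 volume) (hg : MemLp g 2 volume) :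
    HasSobolevDeriv f g ↔ IsWeakDeriv f g :=
  ⟨fun h => h.isWeakDeriv hf hg, fun h => h.hasSobolevDeriv (hf.locallyIntegrable one_le_two)
    (hg.locallyIntegrable one_le_two)⟩

theorem exp_neg_mul_exp_mul (a z : ℂ) : Complex.exp (-a) * (Complex.exp a * z) = z := by
  rw [← mul_assoc, ← Complex.exp_add, neg_add_cancel, Complex.exp_zero, one_mul]

theorem HasSobolevDeriv.exp_mul (h : HasSobolevDeriv f g) (a : ℂ) :
    HasSobolevDeriv (fun t => Complex.exp (a * t) * f t)
      (fun t => Complex.exp (a * t) * (g t + a * f t)) := by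
  have hsmooth : ContDiff ℝ 1 fun t : ℝ => Complex.exp (a * t) :=
    (contDiff_const.mul Complex.ofRealCLM.contDiff).cexp
  refine (h.contDiff_mul hsmooth).congr_ae .rfl (.of_forall fun t => ?_)
  have hderiv := ((hasDerivAt_id (t : ℂ)).const_mul a).cexp.comp_ofReal.deriv
  simp only [id, mul_one] at hderiv
  simp only [hderiv]
  ring

theorem hasSobolevDeriv_exp_mul_iff (a : ℂ) :
    HasSobolevDeriv (fun t => Complex.exp (a * t) * f t)
      (fun t => Complex.exp (a * t) * (g t + a * f t)) ↔ HasSobolevDeriv f g := by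
  refine ⟨fun h => ?_, fun h => h.exp_mul a⟩
  refine (h.exp_mul (-a)).congr_ae (.of_forall fun t => ?_) (.of_forall fun t => ?_)
  · simp only [neg_mul, exp_neg_mul_exp_mul]
  · have hsplit : Complex.exp (a * t) * (g t + a * f t) + -a * (Complex.exp (a * t) * f t) =
        Complex.exp (a * t) * g t := by ring
    simp only [hsplit, neg_mul a (t : ℂ), exp_neg_mul_exp_mul]

end WeakDerivative

section Fourier

theorem ae_eq_iff_forall_integral_schwartz_mul_eq {u v : ℝ → ℂ} (hu : LocallyIntegrable u volume)
    (hv : LocallyIntegrable v volume) :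
    u =ᵐ[volume] v ↔ ∀ φ : 𝓢(ℝ, ℂ), ∫ t, φ t * u t = ∫ t, φ t * v t := by
  refine ⟨fun h φ => integral_congr_ae (.mul .rfl h), fun h => ?_⟩
  refine ae_eq_of_integral_contDiff_smul_eq hu hv fun φ hφ hφc => ?_
  simp only [Complex.real_smul]
  exact h ((hφc.comp_left (g := Complex.ofRealCLM) rfl).toSchwartzMap (by fun_prop))

theorem locallyIntegrable_continuous_mul {w : ℝ → ℂ} (hw : Continuous w)
    (f : Lp ℂ 2 (volume : Measure ℝ)) : LocallyIntegrable (fun t => w t * f t) volume :=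
  ((Lp.memLp f).locallyIntegrable one_le_two).continuous_smul hw

theorem integral_mul_fourier (f : Lp ℂ 2 (volume : Measure ℝ)) (φ : 𝓢(ℝ, ℂ)) :
    ∫ ξ, φ ξ * (𝓕 f : Lp ℂ 2 (volume : Measure ℝ)) ξ = ∫ t, 𝓕 φ t * f t := by
  simpa using (congrArg (fun T => T φ) (Lp.fourier_toTemperedDistribution_eq f)).symm

theorem integral_deriv_fourier_mul (f : Lp ℂ 2 (volume : Measure ℝ)) (φ : 𝓢(ℝ, ℂ)) :
    ∫ t, deriv (𝓕 φ : 𝓢(ℝ, ℂ)) t * f t =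
      -∫ ξ : ℝ, φ ξ * (2 * Real.pi * Complex.I * ξ * (𝓕 f : Lp ℂ 2 (volume : Measure ℝ)) ξ) := by
  have hgrowth : (fun x : ℝ => inner ℝ x (1 : ℝ)).HasTemperateGrowth := by fun_prop
  have hderiv (t : ℝ) : deriv (𝓕 φ : 𝓢(ℝ, ℂ)) t =
      LineDeriv.lineDerivOp (1 : ℝ) (𝓕 φ : 𝓢(ℝ, ℂ)) t := by
    rw [lineDerivOp_apply_eq_fderiv, fderiv_apply_one_eq_deriv]
  simp only [hderiv, lineDerivOp_fourier_eq, ← integral_mul_fourier]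
  rw [← integral_neg]
  congr 1 with ξ
  rw [_root_.smul_apply, smulLeftCLM_apply_apply hgrowth]
  simp only [RCLike.inner_apply, conj_trivial, smul_eq_mul, Complex.real_smul]
  push_cast
  ring

theorem isWeakDeriv_iff_fourier (f g : Lp ℂ 2 (volume : Measure ℝ)) :
    IsWeakDeriv f g ↔ (𝓕 g : Lp ℂ 2 (volume : Measure ℝ)) =ᵐ[volume]
      fun ξ : ℝ => 2 * Real.pi * Complex.I * ξ * (𝓕 f : Lp ℂ 2 (volume : Measure ℝ)) ξ := by
  rw [ae_eq_iff_forall_integral_schwartz_mul_eq ((Lp.memLp _).locallyIntegrable one_le_two)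
    (locallyIntegrable_continuous_mul (by fun_prop) _), IsWeakDeriv,
    (fourierEquiv ℂ 𝓢(ℝ, ℂ)).surjective.forall]
  simp only [fourierEquiv_apply, integral_mul_fourier, integral_deriv_fourier_mul, neg_neg]

theorem fourierInv_compSubConstCLM (ψ : 𝓢(ℝ, ℂ)) (a ξ : ℝ) :
    𝓕⁻ (ψ.compSubConstCLM ℂ a) ξ =
      Complex.exp (2 * Real.pi * Complex.I * a * ξ) * 𝓕⁻ ψ ξ := by
  simp only [fourierInv_coe, Real.fourierInv_eq', compSubConstCLM_apply, smul_eq_mul]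
  rw [← integral_sub_right_eq_self _ (-a), ← integral_const_mul]
  congr 1 with t
  rw [← mul_assoc, ← Complex.exp_add, sub_neg_eq_add, add_sub_cancel_right]
  congr 2
  simp only [RCLike.inner_apply, conj_trivial]
  push_cast
  ring

/-- The translation `f ↦ f (· - a)` as an isometry of `L²(ℝ)`. -/
noncomputable def translateL2 (a : ℝ) :
    Lp ℂ 2 (volume : Measure ℝ) →ₗᵢ[ℂ] Lp ℂ 2 (volume : Measure ℝ) :=
  Lp.compMeasurePreservingₗᵢ ℂ (fun t => t - a) (measurePreserving_sub_right volume a)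

theorem coeFn_translateL2 (a : ℝ) (f : Lp ℂ 2 (volume : Measure ℝ)) :
    translateL2 a f =ᵐ[volume] fun t => f (t - a) :=
  Lp.coeFn_compMeasurePreserving f (measurePreserving_sub_right volume a)

theorem fourier_translateL2 (a : ℝ) (f : Lp ℂ 2 (volume : Measure ℝ)) :
    (𝓕 (translateL2 a f) : Lp ℂ 2 (volume : Measure ℝ)) =ᵐ[volume] fun ξ : ℝ =>
      Complex.exp (-(2 * Real.pi * Complex.I * a * ξ)) *
        (𝓕 f : Lp ℂ 2 (volume : Measure ℝ)) ξ := by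
  refine (ae_eq_iff_forall_integral_schwartz_mul_eq ((Lp.memLp _).locallyIntegrable one_le_two)
    (locallyIntegrable_continuous_mul (by fun_prop) _)).2 fun φ => ?_
  set χ : 𝓢(ℝ, ℂ) := 𝓕⁻ ((𝓕 φ).compSubConstCLM ℂ (-a)) with hχ
  have hχ_apply (ξ : ℝ) : χ ξ = Complex.exp (-(2 * Real.pi * Complex.I * a * ξ)) * φ ξ := by
    rw [hχ, fourierInv_compSubConstCLM, fourierInv_fourier_eq]
    push_cast
    ring_nf
  calc ∫ ξ, φ ξ * (𝓕 (translateL2 a f) : Lp ℂ 2 (volume : Measure ℝ)) ξ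
    _ = ∫ t, 𝓕 φ t * f (t - a) := by
      rw [integral_mul_fourier]
      exact integral_congr_ae (.mul .rfl (coeFn_translateL2 a f))
    _ = ∫ t, 𝓕 χ t * f t := by
      rw [hχ, fourier_fourierInv_eq, ← integral_add_right_eq_self _ a]
      simp only [compSubConstCLM_apply, sub_neg_eq_add, add_sub_cancel_right]
    _ = ∫ ξ, χ ξ * (𝓕 f : Lp ℂ 2 (volume : Measure ℝ)) ξ := (integral_mul_fourier f χ).symm
    _ = _ := by
      congr 1 with ξ
      rw [hχ_apply]
      ring

end Fourier

section Weight

variable {c : ℝ}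

theorem ae_weightMeasure (c : ℝ) : ae (weightMeasure c) = ae volume :=
  le_antisymm (withDensity_absolutelyContinuous _ _).ae_le
    (withDensity_absolutelyContinuous' (by fun_prop)
      (.of_forall fun t => by simp [Real.exp_pos])).ae_le

theorem ae_eq_weightMeasure_iff {f g : ℝ → ℂ} :
    f =ᵐ[weightMeasure c] g ↔ f =ᵐ[volume] g := by
  rw [EventuallyEq, EventuallyEq, ae_weightMeasure]

theorem aestronglyMeasurable_weightMeasure_iff {f : ℝ → ℂ} :
    AEStronglyMeasurable f (weightMeasure c) ↔ AEStronglyMeasurable f volume :=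
  ⟨fun hf => hf.mono_ac (Measure.ae_le_iff_absolutelyContinuous.1 (ae_weightMeasure c).ge),
    fun hf => hf.mono_ac (Measure.ae_le_iff_absolutelyContinuous.1 (ae_weightMeasure c).le)⟩

theorem eLpNorm_weightMeasure (f : ℝ → ℂ) :
    eLpNorm f 2 (weightMeasure c) =
      eLpNorm (fun t : ℝ => Complex.exp (-c * t) * f t) 2 volume := by
  have hnorm (t : ℝ) :
      ‖Complex.exp (-c * t)‖ₑ ^ 2 = ENNReal.ofReal (Real.exp (-2 * c * t)) := by
    rw [← ofReal_norm, Complex.norm_exp, ← ENNReal.ofReal_pow (Real.exp_pos _).le,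
      ← Real.exp_nat_mul, ← Complex.ofReal_neg, ← Complex.ofReal_mul, Complex.ofReal_re]
    push_cast
    ring_nf
  rw [eLpNorm_eq_lintegral_rpow_enorm_toReal two_ne_zero ENNReal.ofNat_ne_top,
    eLpNorm_eq_lintegral_rpow_enorm_toReal two_ne_zero ENNReal.ofNat_ne_top, weightMeasure,
    lintegral_withDensity_eq_lintegral_mul_non_measurable _ (by fun_prop)
      (.of_forall fun t => ENNReal.ofReal_lt_top)]
  simp only [Pi.mul_apply, ENNReal.toReal_ofNat, ENNReal.rpow_ofNat, enorm_mul, mul_pow, hnorm]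

theorem memLp_weightMeasure_iff {f : ℝ → ℂ} :
    MemLp f 2 (weightMeasure c) ↔
      MemLp (fun t : ℝ => Complex.exp (-c * t) * f t) 2 volume := by
  rw [MemLp, MemLp, eLpNorm_weightMeasure, aestronglyMeasurable_weightMeasure_iff]
  refine and_congr_left fun _ => ⟨fun h => .mul (by fun_prop) h, fun h => ?_⟩
  have h' : AEStronglyMeasurable (fun t : ℝ => Complex.exp (-(-c * t)) *
      (Complex.exp (-c * t) * f t)) volume := .mul (by fun_prop) h
  simpa only [exp_neg_mul_exp_mul] using h'

/-- The isometry `f ↦ e^{-ct} f` from `ℍ_c` to `L²(ℝ)`. -/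
noncomputable def weightIsometry (c : ℝ) : WeightedL2 c →ₗᵢ[ℂ] Lp ℂ 2 (volume : Measure ℝ) where
  toFun f := (memLp_weightMeasure_iff.1 (Lp.memLp f)).toLp _
  map_add' f g := by
    rw [← MemLp.toLp_add, MemLp.toLp_eq_toLp_iff]
    filter_upwards [ae_eq_weightMeasure_iff.1 (Lp.coeFn_add f g)] with t ht
    rw [ht, Pi.add_apply, Pi.add_apply, mul_add]
  map_smul' a f := by
    rw [RingHom.id_apply, ← MemLp.toLp_const_smul, MemLp.toLp_eq_toLp_iff]
    filter_upwards [ae_eq_weightMeasure_iff.1 (Lp.coeFn_smul a f)] with t ht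
    rw [ht, Pi.smul_apply, Pi.smul_apply, mul_smul_comm]
  norm_map' f := by
    simp only [LinearMap.coe_mk, AddHom.coe_mk]
    rw [Lp.norm_toLp, ← eLpNorm_weightMeasure, Lp.norm_def]

theorem coeFn_weightIsometry (f : WeightedL2 c) :
    weightIsometry c f =ᵐ[volume] fun t => Complex.exp (-c * t) * f t :=
  (memLp_weightMeasure_iff.1 (Lp.memLp f)).coeFn_toLp

theorem weightIsometry_surjective (c : ℝ) : Function.Surjective (weightIsometry c) := by
  intro g
  have hcancel (t : ℝ) : Complex.exp (-c * t) * (Complex.exp (c * t) * g t) = g t := by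
    rw [neg_mul, exp_neg_mul_exp_mul]
  have hmem : MemLp (fun t : ℝ => Complex.exp (c * t) * g t) 2 (weightMeasure c) := by
    simpa only [memLp_weightMeasure_iff, hcancel] using Lp.memLp g
  refine ⟨hmem.toLp _, Lp.ext ?_⟩
  filter_upwards [coeFn_weightIsometry (hmem.toLp _), ae_eq_weightMeasure_iff.1 hmem.coeFn_toLp]
    with t ht hgt
  rw [ht, hgt, hcancel]

/-- The unitary `f ↦ e^{-ct} f` from `ℍ_c` onto `L²(ℝ)`. -/
noncomputable def weightEquiv (c : ℝ) : WeightedL2 c ≃ₗᵢ[ℂ] Lp ℂ 2 (volume : Measure ℝ) :=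
  .ofSurjective (weightIsometry c) (weightIsometry_surjective c)

theorem coeFn_weightEquiv (f : WeightedL2 c) :
    weightEquiv c f =ᵐ[volume] fun t => Complex.exp (-c * t) * f t :=
  coeFn_weightIsometry f

end Weight

section InfinitesimalShift

variable {c : ℝ}

/-- The unitary `f ↦ 𝓕 (e^{-ct} f)` from `ℍ_c` onto `L²(ℝ)`, which diagonalizes the infinitesimal
shift. -/
noncomputable def fourierWeightEquiv (c : ℝ) :
    WeightedL2 c ≃ₗᵢ[ℂ] Lp ℂ 2 (volume : Measure ℝ) :=
  (weightEquiv c).trans (Lp.fourierTransformₗᵢ ℝ ℂ)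

/-- The symbol `ξ ↦ c + 2πiξ` of the infinitesimal shift. -/
noncomputable def shiftSymbol (c ξ : ℝ) : ℂ := c + 2 * Real.pi * Complex.I * ξ

theorem fourierWeightEquiv_apply (f : WeightedL2 c) :
    fourierWeightEquiv c f = 𝓕 (weightEquiv c f) := rfl

theorem measurable_shiftSymbol (c : ℝ) : Measurable (shiftSymbol c) := by
  unfold shiftSymbol
  fun_prop

theorem shiftSymbol_re (c ξ : ℝ) : (shiftSymbol c ξ).re = c := by
  simp [shiftSymbol]

theorem mem_shiftGraph_iff_hasSobolevDeriv {p : WeightedL2 c × WeightedL2 c} :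
    p ∈ shiftGraph c ↔ HasSobolevDeriv p.1 p.2 := by
  simp only [HasSobolevDeriv, ← ae_weightMeasure c]
  rfl

theorem mem_shiftGraph_iff_isWeakDeriv {f g : WeightedL2 c} :
    (f, g) ∈ shiftGraph c ↔ IsWeakDeriv (weightEquiv c f) (weightEquiv c (g - (c : ℂ) • f)) := by
  rw [mem_shiftGraph_iff_hasSobolevDeriv, ← hasSobolevDeriv_exp_mul_iff (-c),
    ← hasSobolevDeriv_iff_isWeakDeriv (Lp.memLp _) (Lp.memLp _)]
  refine hasSobolevDeriv_congr_ae (coeFn_weightEquiv f).symm ?_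
  filter_upwards [coeFn_weightEquiv (g - (c : ℂ) • f),
    ae_eq_weightMeasure_iff.1 (Lp.coeFn_sub g ((c : ℂ) • f)),
    ae_eq_weightMeasure_iff.1 (Lp.coeFn_smul (c : ℂ) f)] with t ht hsub hsmul
  rw [ht, hsub, Pi.sub_apply, hsmul, Pi.smul_apply, smul_eq_mul, neg_mul, sub_eq_add_neg, neg_mul]

theorem mem_shiftGraph_iff_fourierWeightEquiv {f g : WeightedL2 c} :
    (f, g) ∈ shiftGraph c ↔ fourierWeightEquiv c g =ᵐ[volume]
      fun ξ => shiftSymbol c ξ * fourierWeightEquiv c f ξ := by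
  rw [mem_shiftGraph_iff_isWeakDeriv, isWeakDeriv_iff_fourier, ← fourierWeightEquiv_apply,
    ← fourierWeightEquiv_apply, map_sub, map_smul]
  have hsub := (Lp.coeFn_sub (fourierWeightEquiv c g) ((c : ℂ) • fourierWeightEquiv c f)).trans
    (.sub .rfl (Lp.coeFn_smul (c : ℂ) (fourierWeightEquiv c f)))
  refine ⟨fun h => ?_, fun h => ?_⟩ <;> filter_upwards [hsub, h] with ξ hξ hg
  · rw [hξ, Pi.sub_apply, Pi.smul_apply, smul_eq_mul] at hg
    rw [shiftSymbol]
    linear_combination hg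
  · rw [hξ, Pi.sub_apply, Pi.smul_apply, smul_eq_mul, hg, shiftSymbol]
    ring

theorem diagonalizes_infinitesimalShift (c : ℝ) :
    Diagonalizes (fourierWeightEquiv c) (shiftSymbol c) (infinitesimalShift c) := by
  intro f g
  rw [infinitesimalShift, Submodule.toLinearPMap_graph_eq _ (shiftGraph_singleValued c),
    mem_shiftGraph_iff_fourierWeightEquiv]

theorem functionOfOperator_infinitesimalShift {φ : ℂ → ℂ} (hφ : Measurable φ)
    {T : WeightedL2 c →L[ℂ] WeightedL2 c}
    (hT : ∀ f, fourierWeightEquiv c (T f) =ᵐ[volume]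
      fun ξ => φ (shiftSymbol c ξ) * fourierWeightEquiv c f ξ) :
    functionOfOperator (infinitesimalShift c) φ = boundedAsPartial T :=
  (diagonalizes_infinitesimalShift c).functionOfOperator_eq (diagonalizes_boundedAsPartial hT)
    (measurable_shiftSymbol c) hφ

theorem dense_domain_infinitesimalShift (c : ℝ) :
    Dense ((infinitesimalShift c).domain : Set (WeightedL2 c)) := by
  have hσ := measurable_shiftSymbol c
  exact ((diagonalizes_infinitesimalShift c).isSpectralIntegral (φ := fun s => s) hσ
    measurable_id).dense_domain measurable_id

theorem eq_of_le_boundedAsPartial {H : Type*} [NormedAddCommGroup H] [InnerProductSpace ℂ H]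
    {S : H →ₗ.[ℂ] H} (hS : Dense (S.domain : Set H)) {A B : H →L[ℂ] H}
    (hA : S ≤ boundedAsPartial A) (hB : S ≤ boundedAsPartial B) : A = B := by
  refine ContinuousLinearMap.coeFn_injective <| A.continuous.ext_on hS B.continuous fun x hx => ?_
  have hAx : S ⟨x, hx⟩ = A x := hA.2 (y := ⟨x, Submodule.mem_top⟩) rfl
  have hBx : S ⟨x, hx⟩ = B x := hB.2 (y := ⟨x, Submodule.mem_top⟩) rfl
  exact hAx.symm.trans hBx

end InfinitesimalShift

section Translation

variable {c : ℝ}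

/-- The translation `f ↦ f (· - a)` on `ℍ_c`; conjugation by the weight `e^{-ct}` turns it into
`e^{-ca}` times the translation of `L²(ℝ)`. -/
noncomputable def weightedTranslate (c a : ℝ) : WeightedL2 c →L[ℂ] WeightedL2 c :=
  (Real.exp (-(c * a)) : ℂ) • (((weightEquiv c).symm : Lp ℂ 2 volume →L[ℂ] WeightedL2 c) ∘L
    (translateL2 a).toContinuousLinearMap ∘L (weightEquiv c : WeightedL2 c →L[ℂ] Lp ℂ 2 volume))

theorem weightEquiv_weightedTranslate (a : ℝ) (f : WeightedL2 c) :
    weightEquiv c (weightedTranslate c a f) =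
      (Real.exp (-(c * a)) : ℂ) • translateL2 a (weightEquiv c f) := by
  rw [weightedTranslate, _root_.smul_apply, map_smul]
  exact congrArg _ ((weightEquiv c).apply_symm_apply _)

theorem norm_weightedTranslate_le (c a : ℝ) : ‖weightedTranslate c a‖ ≤ Real.exp (-(c * a)) := by
  refine ContinuousLinearMap.opNorm_le_bound _ (Real.exp_pos _).le fun f => ?_
  rw [← (weightEquiv c).norm_map, weightEquiv_weightedTranslate, norm_smul,
    LinearIsometry.norm_map, LinearIsometryEquiv.norm_map, Complex.norm_real,
    Real.norm_of_nonneg (Real.exp_pos _).le]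

theorem coeFn_weightedTranslate (a : ℝ) (f : WeightedL2 c) :
    weightedTranslate c a f =ᵐ[volume] fun t => f (t - a) := by
  have hweight := coeFn_weightEquiv (weightedTranslate c a f)
  rw [weightEquiv_weightedTranslate] at hweight
  filter_upwards [hweight, Lp.coeFn_smul (Real.exp (-(c * a)) : ℂ)
    (translateL2 a (weightEquiv c f)), coeFn_translateL2 a (weightEquiv c f),
    (measurePreserving_sub_right volume a).quasiMeasurePreserving.ae (coeFn_weightEquiv f)]
    with t hweight hsmul htranslate hf
  rw [hsmul, Pi.smul_apply, htranslate, hf, smul_eq_mul, ← mul_assoc, Complex.ofReal_exp,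
    ← Complex.exp_add] at hweight
  refine mul_left_cancel₀ (Complex.exp_ne_zero (-c * t)) (hweight.symm.trans ?_)
  congr 2
  push_cast
  ring

theorem fourierWeightEquiv_weightedTranslate (a : ℝ) (f : WeightedL2 c) :
    fourierWeightEquiv c (weightedTranslate c a f) =ᵐ[volume]
      fun ξ => Complex.exp (-(a * shiftSymbol c ξ)) * fourierWeightEquiv c f ξ := by
  have hfourier : fourierWeightEquiv c (weightedTranslate c a f) = (Real.exp (-(c * a)) : ℂ) •
      (𝓕 (translateL2 a (weightEquiv c f)) : Lp ℂ 2 (volume : Measure ℝ)) := by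
    rw [fourierWeightEquiv_apply, weightEquiv_weightedTranslate, FourierTransform.fourier_smul]
  rw [hfourier]
  filter_upwards [Lp.coeFn_smul (Real.exp (-(c * a)) : ℂ)
    (𝓕 (translateL2 a (weightEquiv c f)) : Lp ℂ 2 (volume : Measure ℝ)),
    fourier_translateL2 a (weightEquiv c f)] with ξ hsmul htranslate
  rw [hsmul, Pi.smul_apply, htranslate, smul_eq_mul, ← mul_assoc, Complex.ofReal_exp,
    ← Complex.exp_add, fourierWeightEquiv_apply, shiftSymbol]
  congr 2
  push_cast
  ring

end Translation

section Zeta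

variable {c : ℝ}

theorem natCast_cpow_neg (n : ℕ+) (s : ℂ) :
    (n : ℂ) ^ (-s) = Complex.exp (-(Real.log n * s)) := by
  rw [Complex.cpow_def_of_ne_zero (by exact_mod_cast n.ne_zero), ← Complex.natCast_log]
  ring_nf

theorem measurable_natCast_cpow_neg (n : ℕ+) : Measurable fun s : ℂ => (n : ℂ) ^ (-s) := by
  simp only [natCast_cpow_neg]
  fun_prop

theorem summable_pnat_rpow_neg {r : ℝ} (hr : 1 < r) : Summable fun n : ℕ+ => (n : ℝ) ^ (-r) :=
  (Real.summable_nat_rpow.2 (neg_lt_neg hr)).comp_injective PNat.coe_injective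

theorem hasSum_riemannZeta {s : ℂ} (hs : 1 < s.re) :
    HasSum (fun n : ℕ+ => (n : ℂ) ^ (-s)) (riemannZeta s) := by
  have hsum : Summable fun n : ℕ+ => (n : ℂ) ^ (-s) :=
    (summable_pnat_rpow_neg hs).of_norm_bounded fun n => by
      rw [Complex.norm_natCast_cpow_of_pos n.pos, Complex.neg_re]
  convert hsum.hasSum using 1
  rw [zeta_eq_tsum_one_div_nat_add_one_cpow hs, ← Equiv.pnatEquivNat.symm.tsum_eq]
  refine tsum_congr fun n => ?_
  simp [Complex.cpow_neg, Equiv.pnatEquivNat]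

theorem measurable_riemannZeta : Measurable riemannZeta :=
  measurable_of_continuousOn_compl_singleton 1 fun _ hs =>
    (differentiableAt_riemannZeta hs).continuousAt.continuousWithinAt

theorem ae_hasSum_of_summable_norm {X ι F : Type*} [MeasurableSpace X] {μ : Measure X} [Countable ι]
    [NormedAddCommGroup F] [CompleteSpace F] {p : ℝ≥0∞} [Fact (1 ≤ p)] {u : ι → Lp F p μ}
    {v : Lp F p μ} (hnorm : Summable fun n => ‖u n‖) (hsum : HasSum u v) :
    ∀ᵐ t ∂μ, HasSum (fun n => u n t) (v t) := by
  rw [← hsum.tsum_eq]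
  exact Lp.hasSum_coeFn_tsum (tsum_enorm_ne_top_iff_summable_norm.2 hnorm)

/-- The operator `n^{-∂_c}`, defined as the translation by `log n`. -/
noncomputable def natPowShift (c : ℝ) (n : ℕ+) : WeightedL2 c →L[ℂ] WeightedL2 c :=
  weightedTranslate c (Real.log n)

theorem norm_natPowShift_le (n : ℕ+) : ‖natPowShift c n‖ ≤ (n : ℝ) ^ (-c) := by
  refine (norm_weightedTranslate_le _ _).trans_eq ?_
  rw [Real.rpow_def_of_pos (by exact_mod_cast n.pos)]
  ring_nf

theorem fourierWeightEquiv_natPowShift (n : ℕ+) (f : WeightedL2 c) :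
    fourierWeightEquiv c (natPowShift c n f) =ᵐ[volume]
      fun ξ => (n : ℂ) ^ (-shiftSymbol c ξ) * fourierWeightEquiv c f ξ := by
  simpa only [natPowShift, natCast_cpow_neg] using
    fourierWeightEquiv_weightedTranslate (Real.log n) f

theorem functionOfOperator_natCast_cpow_neg (n : ℕ+) :
    functionOfOperator (infinitesimalShift c) (fun s => (n : ℂ) ^ (-s)) =
      boundedAsPartial (natPowShift c n) :=
  functionOfOperator_infinitesimalShift (measurable_natCast_cpow_neg n)
    (fourierWeightEquiv_natPowShift n)

/-- The operator `∑ n^{-∂_c}`, which is `0` by convention where the series diverges in norm. -/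
noncomputable def zetaShift (c : ℝ) : WeightedL2 c →L[ℂ] WeightedL2 c := ∑' n, natPowShift c n

theorem hasSum_natPowShift (hc : 1 < c) : HasSum (natPowShift c) (zetaShift c) :=
  ((summable_pnat_rpow_neg hc).of_norm_bounded fun n => norm_natPowShift_le n).hasSum

theorem hasSum_natPowShift_apply (hc : 1 < c) (f : WeightedL2 c) :
    HasSum (fun n => natPowShift c n f) (zetaShift c f) :=
  (hasSum_natPowShift hc).mapL (ContinuousLinearMap.apply ℂ (WeightedL2 c) f)

theorem summable_norm_natPowShift_apply (hc : 1 < c) (f : WeightedL2 c) :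
    Summable fun n => ‖natPowShift c n f‖ :=
  ((summable_pnat_rpow_neg hc).mul_right ‖f‖).of_nonneg_of_le (fun _ => norm_nonneg _) fun n =>
    (natPowShift c n).le_of_opNorm_le (norm_natPowShift_le n) f

theorem fourierWeightEquiv_zetaShift (hc : 1 < c) (f : WeightedL2 c) :
    fourierWeightEquiv c (zetaShift c f) =ᵐ[volume]
      fun ξ => riemannZeta (shiftSymbol c ξ) * fourierWeightEquiv c f ξ := by
  have hsum : HasSum (fun n => fourierWeightEquiv c (natPowShift c n f))
      (fourierWeightEquiv c (zetaShift c f)) :=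
    (hasSum_natPowShift_apply hc f).map (fourierWeightEquiv c) (fourierWeightEquiv c).continuous
  have hnorm : Summable fun n => ‖fourierWeightEquiv c (natPowShift c n f)‖ := by
    simpa only [LinearIsometryEquiv.norm_map] using summable_norm_natPowShift_apply hc f
  filter_upwards [ae_hasSum_of_summable_norm hnorm hsum,
    ae_all_iff.2 fun n => fourierWeightEquiv_natPowShift n f] with ξ hξ hterm
  simp only [hterm] at hξ
  exact hξ.unique ((hasSum_riemannZeta (by rwa [shiftSymbol_re])).mul_right _)

theorem functionOfOperator_riemannZeta (hc : 1 < c) :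
    functionOfOperator (infinitesimalShift c) riemannZeta = boundedAsPartial (zetaShift c) :=
  functionOfOperator_infinitesimalShift measurable_riemannZeta (fourierWeightEquiv_zetaShift hc)

theorem ae_hasSum_translates (hc : 1 < c) (f : WeightedL2 c) :
    ∀ᵐ t : ℝ, HasSum (fun n : ℕ+ => f (t - Real.log n)) (zetaShift c f t) := by
  have hsum := ae_hasSum_of_summable_norm (summable_norm_natPowShift_apply hc f)
    (hasSum_natPowShift_apply hc f)
  rw [ae_weightMeasure] at hsum
  filter_upwards [hsum, ae_all_iff.2 fun n : ℕ+ => coeFn_weightedTranslate (Real.log n) f]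
    with t ht htranslate
  simpa only [natPowShift, htranslate] using ht

theorem spectralOperator_domain (hc : 1 < c) :
    (spectralOperator c).domain = (infinitesimalShift c).domain := by
  rw [spectralOperator, functionOfOperator_riemannZeta hc]
  exact inf_top_eq _

theorem spectralOperator_le (hc : 1 < c) : spectralOperator c ≤ boundedAsPartial (zetaShift c) :=
  LinearPMap.domRestrict_le.trans_eq (functionOfOperator_riemannZeta hc)

theorem eq_zetaShift_of_spectralOperator_le (hc : 1 < c) {A : WeightedL2 c →L[ℂ] WeightedL2 c}
    (hA : spectralOperator c ≤ boundedAsPartial A) : A = zetaShift c := by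
  refine eq_of_le_boundedAsPartial ?_ hA (spectralOperator_le hc)
  rw [spectralOperator_domain hc]
  exact dense_domain_infinitesimalShift c

end Zeta

theorem theorem3p5 (c : ℝ) (hc : 1 < c) :
    -- `A` is the unique bounded extension of the spectral operator
    ∃ A : WeightedL2 c →L[ℂ] WeightedL2 c,
      spectralOperator c ≤ boundedAsPartial A ∧
      (∀ A' : WeightedL2 c →L[ℂ] WeightedL2 c,
        spectralOperator c ≤ boundedAsPartial A' → A' = A) ∧
      -- `A = ζ(∂_c)`
      functionOfOperator (infinitesimalShift c) riemannZeta = boundedAsPartial A ∧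
      -- `A = ∑ n^{-∂_c}`, with bounded terms and convergence in operator norm
      (∃ N : ℕ+ → (WeightedL2 c →L[ℂ] WeightedL2 c),
        (∀ n : ℕ+, functionOfOperator (infinitesimalShift c) (fun s : ℂ => ((n : ℕ) : ℂ) ^ (-s)) =
          boundedAsPartial (N n)) ∧
        HasSum N A ∧
        -- the series of translates converges to `A f` in `ℍ_c`
        ∀ f : WeightedL2 c,
          (∀ n : ℕ+, ∀ᵐ t : ℝ, N n f t = f (t - Real.log ((n : ℕ) : ℝ))) ∧
          HasSum (fun n : ℕ+ => N n f) (A f)) ∧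
      -- the series of translates converges to `A f` almost everywhere
      ∀ f : WeightedL2 c, ∀ᵐ t : ℝ,
        HasSum (fun n : ℕ+ => f (t - Real.log ((n : ℕ) : ℝ))) (A f t) := by
  exact ⟨zetaShift c, spectralOperator_le hc, fun _ => eq_zetaShift_of_spectralOperator_le hc,
    functionOfOperator_riemannZeta hc,
    ⟨natPowShift c, functionOfOperator_natCast_cpow_neg, hasSum_natPowShift hc, fun f =>
      ⟨fun n => coeFn_weightedTranslate (Real.log n) f, hasSum_natPowShift_apply hc f⟩⟩,
    ae_hasSum_translates hc⟩
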